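/- **Setting.** Let $S^{4n+3}\subset\mathbb H^{n+1}$ be the unit sphere and $S^{4n+3}\to\mathbb{HP}^n$ the Hopf bundle (quotient by right multiplication by unit quaternions), with $\mathbb{HP}^n$ carrying the metric that makes it a Riemannian submersion. Let $B$ be an immersed submanifold of $\mathbb{HP}^n$ with induced metric $g^B$ and Levi-Civita connection $\nabla^B$, and let $\pi:P\to B$ be the principal $S^3$-bundle induced by the Hopf bundle, with the metric $g^P$ induced from $S^{4n+3}$. Assume that $B$ carries a unit Killing vector field $\xi$ such that $\varphi=\nabla^B\xi$ satisfies $(\nabla^B_X\varphi)Y=\eta(Y)X-g^B(X,Y)\xi$, where $\eta=g^B(\xi,\cdot)$ (i.e. $\xi$ is a Sasakian structure on $(B,g^B)$). For a vector field $X$ on $B$ let $X^*$ be its horizontal lift to $P$, i.e. its lift $g^P$-orthogonal to the fibres. Fix imaginary unit quaternions $u_1,u_2,u_3$ with $u_1u_2=u_3$ (for instance $i,j,k$), let $\xi_a$ be the vertical vector field on $P$ whose image at a point $x$ of the sphere is $xu_a$ (so $[\xi_1,\xi_2]=2\xi_3$ and cyclically; this is the 3-Sasakian structure of the fibres), and let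 $\hat\eta_a=g^P(\xi_a,\cdot)$. Let $\mathcal H=(\ker d\pi)^\perp$ be the horizontal distribution, which is an $\mathfrak{sp}(1)$-connection with connection form $\omega=\sum_a\hat\eta_a u_a$, and let $\Omega$ be its curvature form: $\Omega(A,B)=d\omega(A^{h},B^{h})$, where $A^h$ is the $\mathcal H$-component of $A$. Let $J$ be the field of endomorphisms of $TP$ defined by $$J\xi_1=\xi_2,\quad J\xi_2=-\xi_1,\quad J\xi_3=\xi^*,\quad J\xi^*=-\xi_3,\quad JX^*=(\varphi X)^*\ \text{ for } X\perp\xi .$$ **Proposition 4.2.** Assume that 1. $\Omega((\varphi X)^*,(\varphi Y)^*)=\Omega(X^*,Y^*)$ for all vector fields $X,Y\perp\xi$ on $B$ (i.e. $\Omega$ is of type $(1,1)$ with respect to $J$), and 2. $\Omega(X^*,\xi^*)=0$ for every vector field $X\perp\xi$ on $B$. Then the almost complex structure $J$ (a smooth field of endomorphisms with $J^2=-1$) is integrable, in the sense that its Nijenhuis tensor $$[J,J](A_1,A_2)=[A_1,A_2]+J[JA_1,A_2]+J[A_1,JA_2]-[JA_1,JA_2]$$ vanishes. -/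

import Mathlib

open scoped Manifold ContDiff Quaternion Topology

noncomputable section

namespace HopfACS

/-! ### The quaternionic Hopf bundle -/

/-- Quaternionic Euclidean space of dimension `n + 1`, with its Euclidean norm. -/
abbrev QSpace (n : ℕ) : Type := PiLp 2 (fun _ : Fin (n + 1) => ℍ[ℝ])

/-- Right multiplication of a quaternionic vector by a quaternion. -/
def rmul {n : ℕ} (x : QSpace n) (q : ℍ[ℝ]) : QSpace n := WithLp.toLp 2 (fun a => x a * q)

@[simp] theorem rmul_apply {n : ℕ} (x : QSpace n) (q : ℍ[ℝ]) (a : Fin (n + 1)) :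
    rmul x q a = x a * q := rfl

/-- The real dimension of the quaternionic vector space is `4n + 4`. -/
instance finrank_qSpace (n : ℕ) : Fact (Module.finrank ℝ (QSpace n) = (4 * n + 3) + 1) := by
  refine ⟨?_⟩
  rw [(WithLp.linearEquiv 2 ℝ (Fin (n + 1) → ℍ[ℝ])).finrank_eq, Module.finrank_pi_fintype]
  simp [Quaternion.finrank_eq_four]
  ring

/-- The unit sphere of dimension `4n + 3`; its smooth structure is the one of Mathlib. -/
abbrev S (n : ℕ) : Type := Metric.sphere (0 : QSpace n) 1

/-- Two points of the sphere are equivalent when they differ by right multiplication by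
a unit quaternion. -/
def hopfSetoid (n : ℕ) : Setoid (S n) where
  r x y := ∃ q : ℍ[ℝ], ‖q‖ = 1 ∧ (y : QSpace n) = rmul (x : QSpace n) q
  iseqv := by
    refine ⟨fun x => ⟨1, by simp, by ext a : 1; simp⟩, ?_, ?_⟩
    · rintro x y ⟨q, hq, h⟩
      have hq0 : q ≠ 0 := by rintro rfl; simp at hq
      refine ⟨q⁻¹, by simp [hq], ?_⟩
      rw [h]; ext a : 1
      simp [hq0]
    · rintro x y z ⟨q, hq, h⟩ ⟨r, hr, h'⟩
      refine ⟨q * r, by simp [hq, hr], ?_⟩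
      rw [h', h]; ext a : 1
      simp [mul_assoc]

/-- Quaternionic projective space, as the quotient of the sphere by the right action of the
unit quaternions, with the quotient topology. -/
def HP (n : ℕ) : Type := Quotient (hopfSetoid n)

instance (n : ℕ) : TopologicalSpace (HP n) :=
  inferInstanceAs (TopologicalSpace (Quotient (hopfSetoid n)))

/-- The Hopf map from the sphere to quaternionic projective space. -/
def hopf {n : ℕ} (x : S n) : HP n := Quotient.mk (hopfSetoid n) x

theorem isQuotientMap_hopf (n : ℕ) : Topology.IsQuotientMap (hopf (n := n)) :=
  isQuotientMap_quotient_mk'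

theorem smul_mul_smul_inv {r : ℝ} (hr : r ≠ 0) (a b : ℍ[ℝ]) :
    (r • a) * (r • b)⁻¹ = a * b⁻¹ := by
  rcases eq_or_ne b 0 with rfl | hb
  · simp
  · have h : (r • b)⁻¹ = r⁻¹ • b⁻¹ := by
      refine inv_eq_of_mul_eq_one_right ?_
      rw [smul_mul_smul_comm, mul_inv_cancel₀ hr, mul_inv_cancel₀ hb, one_smul]
    rw [h, smul_mul_smul_comm, mul_inv_cancel₀ hr, one_smul]

theorem contDiffAt_quaternion_inv {q : ℍ[ℝ]} (hq : q ≠ 0) :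
    ContDiffAt ℝ ∞ (fun r : ℍ[ℝ] => r⁻¹) q := by
  have h := contDiffAt_ringInverse ℝ (n := ∞) (Units.mk0 q hq)
  rwa [Ring.inverse_eq_inv'] at h

/-- The norm of the `k`-th homogeneous coordinate (of a representative of norm one). -/
def coordNorm {n : ℕ} (k : Fin (n + 1)) : HP n → ℝ :=
  Quotient.lift (fun x : S n => ‖(x : QSpace n) k‖) (by
    rintro x y ⟨q, hq, h⟩
    simp [h, hq])

/-- The `k`-th system of affine coordinates `x ↦ (x_i x_k⁻¹)_{i ≠ k}`. -/
def affineCoord {n : ℕ} (k : Fin (n + 1)) : HP n → (Fin n → ℍ[ℝ]) :=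
  Quotient.lift
    (fun (x : S n) i => (x : QSpace n) (k.succAbove i) * ((x : QSpace n) k)⁻¹) (by
    rintro x y ⟨q, hq, h⟩
    have hq0 : q ≠ 0 := by rintro rfl; simp at hq
    funext i
    simp [h, mul_inv_rev, mul_assoc, hq0])

/-- The vector with `k`-th coordinate `1` and the other coordinates given by `y`. -/
def affinePoint {n : ℕ} (k : Fin (n + 1)) (y : Fin n → ℍ[ℝ]) : QSpace n :=
  WithLp.toLp 2 (k.insertNth (α := fun _ => ℍ[ℝ]) 1 y)

@[simp] theorem affinePoint_same {n : ℕ} (k : Fin (n + 1)) (y : Fin n → ℍ[ℝ]) :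
    affinePoint k y k = 1 := by simp [affinePoint]

@[simp] theorem affinePoint_succAbove {n : ℕ} (k : Fin (n + 1)) (y : Fin n → ℍ[ℝ]) (i : Fin n) :
    affinePoint k y (k.succAbove i) = y i := by simp [affinePoint]

theorem affinePoint_ne_zero {n : ℕ} (k : Fin (n + 1)) (y : Fin n → ℍ[ℝ]) :
    affinePoint k y ≠ 0 := by
  intro h
  have := affinePoint_same k y
  rw [h] at this
  simp at this

theorem contDiff_affinePoint {n : ℕ} (k : Fin (n + 1)) :
    ContDiff ℝ ∞ (affinePoint (n := n) k) := by
  rw [contDiff_piLp]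
  intro a
  induction a using Fin.succAboveCases k with
  | x => simpa using contDiff_const
  | p i => simpa using contDiff_apply ℝ ℍ[ℝ] i

/-- The point of the sphere obtained by normalizing `affinePoint k y`. -/
def affineSphere {n : ℕ} (k : Fin (n + 1)) (y : Fin n → ℍ[ℝ]) : S n :=
  ⟨‖affinePoint k y‖⁻¹ • affinePoint k y, by
    simp [norm_smul, affinePoint_ne_zero]⟩

/-- The `k`-th affine chart of quaternionic projective space. -/
def affineChart {n : ℕ} (k : Fin (n + 1)) : OpenPartialHomeomorph (HP n) (Fin n → ℍ[ℝ]) where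
  toFun := affineCoord k
  invFun y := hopf (affineSphere k y)
  source := {z | coordNorm k z ≠ 0}
  target := Set.univ
  map_source' _ _ := Set.mem_univ _
  map_target' y _ := by
    change ‖(affineSphere k y : QSpace n) k‖ ≠ 0
    simp [affineSphere, affinePoint_ne_zero]
  left_inv' := by
    intro z hz
    induction z using Quotient.inductionOn with | _ x => ?_
    have hk : (x : QSpace n) k ≠ 0 := by
      intro h
      apply hz
      change ‖(x : QSpace n) k‖ = 0
      simp [h]
    apply Quotient.sound
    set y := affineCoord k (hopf x) with hy
    have hx : affinePoint k y = rmul (x : QSpace n) ((x : QSpace n) k)⁻¹ := by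
      ext a : 1
      induction a using Fin.succAboveCases k with
      | x => simp [hk]
      | p i => simp [hy, affineCoord, hopf]
    have hn0 : (‖affinePoint k y‖ : ℝ) ≠ 0 := by simp [affinePoint_ne_zero]
    have hsph : (x : QSpace n) = rmul (affineSphere k y : QSpace n)
        ((‖affinePoint k y‖ : ℝ) • (x : QSpace n) k) := by
      ext a : 1
      simp [affineSphere, hx, hk]
      rw [← hx, smul_smul, mul_inv_cancel₀ hn0, one_smul]
    refine ⟨(‖affinePoint k y‖ : ℝ) • (x : QSpace n) k, ?_, hsph⟩
    have h1 : ‖(x : QSpace n)‖ = 1 := by simp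
    have h2 : ‖(affineSphere k y : QSpace n)‖ = 1 := by simp
    have h3 : ∀ (w : QSpace n) (q : ℍ[ℝ]), ‖rmul w q‖ = ‖w‖ * ‖q‖ := by
      intro w q
      rw [PiLp.norm_eq_of_L2, PiLp.norm_eq_of_L2]
      simp only [rmul_apply, norm_mul, mul_pow]
      rw [← Finset.sum_mul, Real.sqrt_mul (by positivity), Real.sqrt_sq (norm_nonneg _)]
    rw [hsph, h3, h2, one_mul] at h1
    exact h1
  right_inv' := by
    intro y _
    funext i
    change (affineSphere k y : QSpace n) (k.succAbove i) *
      ((affineSphere k y : QSpace n) k)⁻¹ = y i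
    have hn0 : (‖affinePoint k y‖ : ℝ) ≠ 0 := by simp [affinePoint_ne_zero]
    refine (smul_mul_smul_inv (inv_ne_zero hn0) _ _).trans ?_
    simp
  open_source := by
    rw [← (isQuotientMap_hopf n).isOpen_preimage]
    change IsOpen {x : S n | ‖(x : QSpace n) k‖ ≠ 0}
    exact isOpen_ne_fun (by fun_prop) continuous_const
  open_target := isOpen_univ
  continuousOn_toFun := by
    rw [(isQuotientMap_hopf n).continuousOn_isOpen_iff]
    · change ContinuousOn (fun (x : S n) i =>
        (x : QSpace n) (k.succAbove i) * ((x : QSpace n) k)⁻¹) {x : S n | ‖(x : QSpace n) k‖ ≠ 0}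
      refine continuousOn_pi.2 fun i => ContinuousOn.mul (by fun_prop) ?_
      refine ContinuousOn.inv₀ (by fun_prop) ?_
      intro x hx
      simpa using hx
    · rw [← (isQuotientMap_hopf n).isOpen_preimage]
      change IsOpen {x : S n | ‖(x : QSpace n) k‖ ≠ 0}
      exact isOpen_ne_fun (by fun_prop) continuous_const
  continuousOn_invFun := by
    refine Continuous.continuousOn ?_
    refine (isQuotientMap_hopf n).continuous.comp ?_
    refine Continuous.subtype_mk ?_ _
    have hc : Continuous (affinePoint (n := n) k) := (contDiff_affinePoint k).continuous
    exact (hc.norm.inv₀ (by simp [affinePoint_ne_zero])).smul hc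

theorem exists_coordNorm_ne_zero {n : ℕ} (z : HP n) : ∃ k, coordNorm k z ≠ 0 := by
  induction z using Quotient.inductionOn with | _ x => ?_
  by_contra! h
  have hx : (x : QSpace n) = 0 := by
    ext a : 1
    exact norm_eq_zero.1 (h a)
  have h1 : ‖(x : QSpace n)‖ = 1 := by simp
  simp [hx] at h1

/-- The atlas of affine charts. -/
instance (n : ℕ) : ChartedSpace (Fin n → ℍ[ℝ]) (HP n) where
  atlas := Set.range affineChart
  chartAt z := affineChart (exists_coordNorm_ne_zero z).choose
  mem_chart_source z := (exists_coordNorm_ne_zero z).choose_spec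
  chart_mem_atlas _ := Set.mem_range_self _

/-- The affine charts make quaternionic projective space a smooth manifold. -/
instance (n : ℕ) : IsManifold 𝓘(ℝ, Fin n → ℍ[ℝ]) ∞ (HP n) := by
  refine isManifold_of_contDiffOn _ _ _ ?_
  rintro _ _ ⟨k, rfl⟩ ⟨l, rfl⟩
  have key : ∀ y : Fin n → ℍ[ℝ], affineCoord l (hopf (affineSphere k y)) =
      fun i => affinePoint k y (l.succAbove i) * (affinePoint k y l)⁻¹ := by
    intro y
    funext i
    change (affineSphere k y : QSpace n) (l.succAbove i) *
      ((affineSphere k y : QSpace n) l)⁻¹ = _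
    have hn0 : (‖affinePoint k y‖ : ℝ) ≠ 0 := by simp [affinePoint_ne_zero]
    exact smul_mul_smul_inv (inv_ne_zero hn0) _ _
  have hs : ∀ y : Fin n → ℍ[ℝ], coordNorm l (hopf (affineSphere k y)) ≠ 0 →
      affinePoint k y l ≠ 0 := by
    intro y hy h
    apply hy
    change ‖(affineSphere k y : QSpace n) l‖ = 0
    simp [affineSphere, h]
  have hf : ((affineChart k).symm.trans (affineChart l) : (Fin n → ℍ[ℝ]) → (Fin n → ℍ[ℝ])) =
      fun y i => affinePoint k y (l.succAbove i) * (affinePoint k y l)⁻¹ := by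
    funext y
    exact key y
  have hcd : ∀ a, ContDiff ℝ ∞ fun y => affinePoint (n := n) k y a := fun a =>
    (contDiff_piLp 2).1 (contDiff_affinePoint k) a
  simp only [modelWithCornersSelf_coe, modelWithCornersSelf_coe_symm, Set.range_id,
    Set.inter_univ, Set.preimage_id_eq, id_eq, Function.comp_id, Function.id_comp]
  rw [hf]
  refine contDiffOn_pi.2 fun i y hy => ?_
  have hy' : affinePoint k y l ≠ 0 := hs y hy.2
  refine ContDiffAt.contDiffWithinAt ?_
  exact (hcd _).contDiffAt.mul (ContDiffAt.comp y (contDiffAt_quaternion_inv hy') (hcd l).contDiffAt)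

/-! ### The metric of quaternionic projective space -/

/-- The Riemannian metric of the unit sphere. -/
def sphereMetric {n : ℕ} (x : S n) (s t : TangentSpace (𝓡 (4 * n + 3)) x) : ℝ :=
  inner ℝ (mvfderiv (𝓡 (4 * n + 3)) (fun y : S n => (y : QSpace n)) x s)
    (mvfderiv (𝓡 (4 * n + 3)) (fun y : S n => (y : QSpace n)) x t)

/-- The differential of the Hopf map. -/
def dHopf {n : ℕ} (x : S n) :
    TangentSpace (𝓡 (4 * n + 3)) x →L[ℝ] TangentSpace 𝓘(ℝ, Fin n → ℍ[ℝ]) (hopf x) :=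
  mfderiv (𝓡 (4 * n + 3)) 𝓘(ℝ, Fin n → ℍ[ℝ]) hopf x

/-- The horizontal lift to `x` of a tangent vector at `hopf x`: the tangent vector of the sphere
over `v` that is orthogonal to the Hopf fibre, i.e. to the kernel of the differential. -/
def hopfLift {n : ℕ} (x : S n) (v : TangentSpace 𝓘(ℝ, Fin n → ℍ[ℝ]) (hopf x)) :
    TangentSpace (𝓡 (4 * n + 3)) x :=
  Classical.epsilon fun t => dHopf x t = v ∧ ∀ s, dHopf x s = 0 → sphereMetric x s t = 0

theorem hopf_out {n : ℕ} (z : HP n) : hopf (Quotient.out z) = z := Quotient.out_eq z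

/-- The standard metric of quaternionic projective space, which makes the Hopf map a Riemannian
submersion: the scalar product of the horizontal lifts to a point over `z`. -/
def hpMetric {n : ℕ} (z : HP n) (v w : TangentSpace 𝓘(ℝ, Fin n → ℍ[ℝ]) z) : ℝ :=
  sphereMetric (Quotient.out z) (hopfLift (Quotient.out z) ((hopf_out z).symm ▸ v))
    (hopfLift (Quotient.out z) ((hopf_out z).symm ▸ w))

/-! ### Smooth vector fields, Levi-Civita connections, Sasakian structures -/

section Manifold

variable {d : ℕ} {M : Type*} [TopologicalSpace M] [ChartedSpace (EuclideanSpace ℝ (Fin d)) M]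
  [IsManifold (𝓡 d) ∞ M]

/-- A vector field is smooth at a point. -/
def SmoothFieldAt (X : ∀ x : M, TangentSpace (𝓡 d) x) (x : M) : Prop :=
  ContMDiffAt (𝓡 d) (𝓡 d).tangent ∞ (fun y => (⟨y, X y⟩ : TangentBundle (𝓡 d) M)) x

/-- A smooth vector field. -/
def SmoothField (X : ∀ x : M, TangentSpace (𝓡 d) x) : Prop := ∀ x, SmoothFieldAt X x

/-- The covariant derivatives on the tangent bundle of `M`; for such a `nabla`, the vector
`nabla Y x v` is the derivative of the vector field `Y` at `x` in the direction `v`. -/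
abbrev Connection (d : ℕ) (M : Type*) [TopologicalSpace M]
    [ChartedSpace (EuclideanSpace ℝ (Fin d)) M] [IsManifold (𝓡 d) ∞ M] : Type _ :=
  CovariantDerivative (𝓡 d) (EuclideanSpace ℝ (Fin d)) (fun x : M => TangentSpace (𝓡 d) x)

/-- `nabla` is the Levi-Civita connection of the metric `g`: it is a connection (it maps smooth
fields to smooth fields), torsion-free and compatible with `g`. -/
structure IsLeviCivita (g : ∀ x : M, TangentSpace (𝓡 d) x → TangentSpace (𝓡 d) x → ℝ)
    (nabla : Connection d M) : Prop where
  smooth : ∀ (X Y : ∀ x : M, TangentSpace (𝓡 d) x), SmoothField X → SmoothField Y →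
    SmoothField (fun x => nabla Y x (X x))
  torsion_free : ∀ (X Y : ∀ x : M, TangentSpace (𝓡 d) x), SmoothField X → SmoothField Y →
    ∀ x, nabla Y x (X x) - nabla X x (Y x) = VectorField.mlieBracket (𝓡 d) X Y x
  metric : ∀ (X Y Z : ∀ x : M, TangentSpace (𝓡 d) x), SmoothField X → SmoothField Y →
    SmoothField Z → ∀ x, mvfderiv (𝓡 d) (fun y => g y (Y y) (Z y)) x (X x) =
      g x (nabla Y x (X x)) (Z x) + g x (Y x) (nabla Z x (X x))

/-- `xi` is a Sasakian structure for the metric `g` with Levi-Civita connection `nabla`: a smooth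
unit Killing field such that `phi = nabla xi` satisfies
`(nabla_X phi) Y = eta(Y) X - g(X, Y) xi`, where `eta = g(xi, ·)`. -/
structure IsSasakian (g : ∀ x : M, TangentSpace (𝓡 d) x → TangentSpace (𝓡 d) x → ℝ)
    (nabla : Connection d M) (xi : ∀ x : M, TangentSpace (𝓡 d) x) : Prop where
  leviCivita : IsLeviCivita g nabla
  smooth : SmoothField xi
  unit : ∀ x, g x (xi x) (xi x) = 1
  killing : ∀ (x : M) (v w : TangentSpace (𝓡 d) x),
    g x (nabla xi x v) w + g x v (nabla xi x w) = 0
  deriv_phi : ∀ (X Y : ∀ x : M, TangentSpace (𝓡 d) x), SmoothField X → SmoothField Y → ∀ x,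
    nabla (fun y => nabla xi y (Y y)) x (X x) - nabla xi x (nabla Y x (X x)) =
      g x (xi x) (Y x) • X x - g x (X x) (Y x) • xi x

/-- `J` is an almost complex structure on `M`: a smooth field of endomorphisms of the tangent
spaces with square `-1`. -/
structure IsAlmostComplex (J : ∀ x : M, TangentSpace (𝓡 d) x → TangentSpace (𝓡 d) x) : Prop where
  map_add : ∀ (x : M) (v w : TangentSpace (𝓡 d) x), J x (v + w) = J x v + J x w
  map_smul : ∀ (x : M) (c : ℝ) (v : TangentSpace (𝓡 d) x), J x (c • v) = c • J x v
  square : ∀ (x : M) (v : TangentSpace (𝓡 d) x), J x (J x v) = -v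
  smooth : ∀ (A : ∀ x : M, TangentSpace (𝓡 d) x) (x : M), SmoothFieldAt A x →
    SmoothFieldAt (fun y => J y (A y)) x

/-- The Nijenhuis tensor `[J, J](A₁, A₂) = [A₁, A₂] + J[JA₁, A₂] + J[A₁, JA₂] - [JA₁, JA₂]`. -/
def nijenhuis (J : ∀ x : M, TangentSpace (𝓡 d) x → TangentSpace (𝓡 d) x)
    (A₁ A₂ : ∀ x : M, TangentSpace (𝓡 d) x) (x : M) : TangentSpace (𝓡 d) x :=
  VectorField.mlieBracket (𝓡 d) A₁ A₂ x
    + J x (VectorField.mlieBracket (𝓡 d) (fun y => J y (A₁ y)) A₂ x)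
    + J x (VectorField.mlieBracket (𝓡 d) A₁ (fun y => J y (A₂ y)) x)
    - VectorField.mlieBracket (𝓡 d) (fun y => J y (A₁ y)) (fun y => J y (A₂ y)) x

/-- `J` is integrable, in the sense that its Nijenhuis tensor vanishes. -/
def IsIntegrable (J : ∀ x : M, TangentSpace (𝓡 d) x → TangentSpace (𝓡 d) x) : Prop :=
  ∀ (A₁ A₂ : ∀ x : M, TangentSpace (𝓡 d) x) (x : M), SmoothFieldAt A₁ x → SmoothFieldAt A₂ x →
    nijenhuis J A₁ A₂ x = 0

end Manifold

/-! ### Induced Hopf bundles -/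

/-- A positively oriented orthonormal basis `(u 0, u 1, u 2)` of the imaginary quaternions
(the standard example being `i, j, k`); it determines a 3-Sasakian structure on the
Hopf fibres. -/
structure IsQuaternionTriple (u : Fin 3 → ℍ[ℝ]) : Prop where
  re_eq_zero : ∀ a, (u a).re = 0
  norm_eq_one : ∀ a, ‖u a‖ = 1
  mul_eq : u 0 * u 1 = u 2

/-- An immersed submanifold `incl : B → HP n` together with the principal bundle `proj : P → B`
induced by the Hopf bundle, i.e. `P` is the embedded submanifold
`{(b, x) | incl b = hopf x}` of `B × S n`; `proj` and `toSphere` are the two projections. -/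
structure InducedHopfBundle (n m : ℕ) (B P : Type*)
    [TopologicalSpace B] [ChartedSpace (EuclideanSpace ℝ (Fin m)) B]
    [TopologicalSpace P] [ChartedSpace (EuclideanSpace ℝ (Fin (m + 3))) P] where
  incl : B → HP n
  isImmersion : Manifold.IsImmersion (𝓡 m) 𝓘(ℝ, Fin n → ℍ[ℝ]) ∞ incl
  proj : P → B
  toSphere : P → S n
  isSmoothEmbedding : Manifold.IsSmoothEmbedding (𝓡 (m + 3)) ((𝓡 m).prod (𝓡 (4 * n + 3))) ∞
    (fun p => (proj p, toSphere p))
  range_eq : Set.range (fun p => (proj p, toSphere p)) = {y : B × S n | incl y.1 = hopf y.2}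

namespace InducedHopfBundle

variable {n m : ℕ} {B P : Type*}
  [TopologicalSpace B] [ChartedSpace (EuclideanSpace ℝ (Fin m)) B]
  [TopologicalSpace P] [ChartedSpace (EuclideanSpace ℝ (Fin (m + 3))) P]
  (D : InducedHopfBundle n m B P)

/-- The metric induced on `B` by `HP n`. -/
def baseMetric (b : B) (v w : TangentSpace (𝓡 m) b) : ℝ :=
  hpMetric (D.incl b) (mfderiv (𝓡 m) 𝓘(ℝ, Fin n → ℍ[ℝ]) D.incl b v)
    (mfderiv (𝓡 m) 𝓘(ℝ, Fin n → ℍ[ℝ]) D.incl b w)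

/-- The differential of the map from `P` to the sphere, with values in the ambient vector space. -/
def dSphere (p : P) : TangentSpace (𝓡 (m + 3)) p →L[ℝ] QSpace n :=
  mvfderiv (𝓡 (m + 3)) (fun q : P => (D.toSphere q : QSpace n)) p

/-- The differential of the bundle projection. -/
def dProj (p : P) : TangentSpace (𝓡 (m + 3)) p →L[ℝ] TangentSpace (𝓡 m) (D.proj p) :=
  mfderiv (𝓡 (m + 3)) (𝓡 m) D.proj p

/-- The metric induced on `P` by the sphere. -/
def totalMetric (p : P) (v w : TangentSpace (𝓡 (m + 3)) p) : ℝ :=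
  inner ℝ (D.dSphere p v) (D.dSphere p w)

/-- The fundamental vertical vector field on `P` of an imaginary quaternion `q`: the velocity
at `0` of the right action of `exp (t q)`. It is tangent to the fibre, and its image
at the point `x` of the sphere is `x q`. -/
def fundamental (q : ℍ[ℝ]) (p : P) : TangentSpace (𝓡 (m + 3)) p :=
  Classical.epsilon fun v =>
    D.dProj p v = 0 ∧ D.dSphere p v = rmul (D.toSphere p : QSpace n) q

/-- The horizontal lift of a tangent vector of `B`: the vector over it that is orthogonal
to the fibre for the metric of `P`. -/
def lift (p : P) (v : TangentSpace (𝓡 m) (D.proj p)) : TangentSpace (𝓡 (m + 3)) p :=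
  Classical.epsilon fun w => D.dProj p w = v ∧ ∀ s, D.dProj p s = 0 → D.totalMetric p s w = 0

/-- The horizontal lift of a vector field of `B`. -/
def liftField (X : ∀ b : B, TangentSpace (𝓡 m) b) (p : P) : TangentSpace (𝓡 (m + 3)) p :=
  D.lift p (X (D.proj p))

variable (u : Fin 3 → ℍ[ℝ])

/-- The 1-forms dual to the vertical fields `fundamental (u a)` with respect to the
metric of `P`. -/
def etaHat (a : Fin 3) (p : P) (v : TangentSpace (𝓡 (m + 3)) p) : ℝ :=
  D.totalMetric p (D.fundamental (u a) p) v

/-- The connection form of the horizontal distribution, with values in the imaginary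
quaternions (the Lie algebra of the unit quaternions). -/
def connForm (p : P) (v : TangentSpace (𝓡 (m + 3)) p) : ℍ[ℝ] :=
  ∑ a, D.etaHat u a p v • u a

/-- The exterior derivative of the connection form, evaluated on two vector fields. -/
def dConnForm (A₁ A₂ : ∀ p : P, TangentSpace (𝓡 (m + 3)) p) (p : P) : ℍ[ℝ] :=
  mvfderiv (𝓡 (m + 3)) (fun q => D.connForm u q (A₂ q)) p (A₁ p)
    - mvfderiv (𝓡 (m + 3)) (fun q => D.connForm u q (A₁ q)) p (A₂ p)
    - D.connForm u p (VectorField.mlieBracket (𝓡 (m + 3)) A₁ A₂ p)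

/-- The horizontal part of a vector field on `P`. -/
def horizontal (A : ∀ p : P, TangentSpace (𝓡 (m + 3)) p) (p : P) : TangentSpace (𝓡 (m + 3)) p :=
  A p - ∑ a, D.etaHat u a p (A p) • D.fundamental (u a) p

/-- The curvature form of the connection: the exterior derivative of the connection form on the
horizontal parts. -/
def curvature (A₁ A₂ : ∀ p : P, TangentSpace (𝓡 (m + 3)) p) (p : P) : ℍ[ℝ] :=
  D.dConnForm u (D.horizontal u A₁) (D.horizontal u A₂) p

/-- The almost complex structure on `P`. With `ξ₁, ξ₂, ξ₃` the vertical fields given by `u`, it is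
the field of endomorphisms such that `J ξ₁ = ξ₂`, `J ξ₂ = -ξ₁`, `J ξ₃ = ξ*`, `J ξ* = -ξ₃` and
`J X* = (φ X)*` for `X` orthogonal to `ξ`; here this is written out on the components of a
vector in the decomposition of the tangent space of `P` into the span of `ξ₁, ξ₂, ξ₃`, the
span of `ξ*`, and the lifts of the vectors orthogonal to `ξ`. -/
def acs (phi : ∀ b : B, TangentSpace (𝓡 m) b →L[ℝ] TangentSpace (𝓡 m) b)
    (xi : ∀ b : B, TangentSpace (𝓡 m) b) (p : P) (v : TangentSpace (𝓡 (m + 3)) p) :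
    TangentSpace (𝓡 (m + 3)) p :=
  D.etaHat u 0 p v • D.fundamental (u 1) p
    - D.etaHat u 1 p v • D.fundamental (u 0) p
    + D.etaHat u 2 p v • D.liftField xi p
    - D.baseMetric (D.proj p) (xi (D.proj p)) (D.dProj p v) • D.fundamental (u 2) p
    + D.lift p (phi (D.proj p) (D.dProj p v
        - D.baseMetric (D.proj p) (xi (D.proj p)) (D.dProj p v) • xi (D.proj p)))

end InducedHopfBundle

end HopfACS

end

open HopfACS

/-!
The metric of `P` and the form `Ω` enter only through brackets of vector fields. The tangent space
of `P` is spanned by the vertical fields `ξ₁, ξ₂, ξ₃` and by the horizontal lifts `X*` of fields on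
`B`, and the brackets of these generators are

* `[ξ₁, ξ₂] = 2 ξ₃` and cyclically (`mlieBracket_fundamental`);
* `[ξₐ, X*] = 0`, as horizontal lifts are invariant under the structure group
  (`mlieBracket_fundamental_liftField`);
* `[X*, Y*]`, whose projection to `B` is `[X, Y]` (`dProj_mlieBracket_liftField`) and whose vertical
  part is `-Ω(X*, Y*)` (`curvature_liftField`).

The Nijenhuis tensor is `C^∞`-bilinear, alternating and satisfies `[J, J](JA, C) = -J [J, J](A, C)`.
As `Jξ₁ = ξ₂` and `Jξ₃ = ξ*`, it has to be evaluated only on `ξ₁`, `ξ₃` and the lifts `X*` of fields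
`X ⊥ ξ` (`isIntegrable_of_complex_frame`):

* on `(ξ₁, ξ₃)` and on `(ξ₁, X*)` the bracket relations suffice;
* on `(ξ₃, X*)` it is `J[ξ*, X*] - [ξ*, (φX)*]`. By the second hypothesis both brackets are
  horizontal, and the flow of `ξ` preserves both `φ` and the contact distribution
  (`IsSasakian.mlieBracket_xi_phi`, `IsSasakian.eta_mlieBracket_xi`);
* on `(X*, Y*)` the projection to `B` is the corresponding expression for `φ`, which vanishes since
  a Sasakian structure is normal (`IsSasakian.nijenhuis_phi`). The vertical part vanishes by the first
  hypothesis and, for the `ξ₃`-component contributed by `Jξ* = -ξ₃`, by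
  `IsSasakian.eta_mlieBracket_phi`.

The identities on `B` follow from the covariant derivative of `φ` by expressing brackets through the
Levi-Civita connection. Smoothness on `P` is tested on the coframe formed by the projection to `B`
and the forms `η̂ₐ` (`smoothFieldAt_of_proj_of_etaHat`). That lifts and fundamental fields exist at
all is a dimension count: the tangent spaces of `P` are the fibre products of those of `B` and of
the sphere over those of the projective space (`exists_dProj_eq_dToSphere_eq`).
-/

open scoped Manifold ContDiff Quaternion Topology

noncomputable section

namespace HopfACS

open Bundle Filter Function Set Module

/-! ### Derivatives along Lie brackets -/

section General

variable {d : ℕ} {M : Type*} [TopologicalSpace M] [ChartedSpace (EuclideanSpace ℝ (Fin d)) M]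
  [IsManifold (𝓡 d) ∞ M]
  {V : Type*} [NormedAddCommGroup V] [NormedSpace ℝ V]

theorem SmoothFieldAt.mdifferentiableAt {A : ∀ x : M, TangentSpace (𝓡 d) x} {x : M}
    (hA : SmoothFieldAt A x) :
    MDifferentiableAt (𝓡 d) (𝓡 d).tangent (fun y => (⟨y, A y⟩ : TangentBundle (𝓡 d) M)) x :=
  ContMDiffAt.mdifferentiableAt hA (by simp)

/-- The derivative of a smooth function along a smooth field is smooth. -/
theorem contMDiffAt_mvfderiv_apply {F : M → V} {x : M} (hF : ContMDiffAt (𝓡 d) 𝓘(ℝ, V) ∞ F x)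
    {A : ∀ x : M, TangentSpace (𝓡 d) x} (hA : SmoothFieldAt A x) :
    ContMDiffAt (𝓡 d) 𝓘(ℝ, V) ∞ (fun y => mvfderiv (𝓡 d) F y (A y)) x := by
  have h1 := hF.mfderiv_const (m := ∞) (by simp)
  have h2 := ContMDiffAt.clm_apply_of_inCoordinates (b₁ := id) (b₂ := F)
    (ϕ := fun y => mfderiv (𝓡 d) 𝓘(ℝ, V) F y) h1 hA hF
  exact (contMDiff_snd_tangentBundle_modelSpace V 𝓘(ℝ, V)).contMDiffAt.comp x h2

theorem mdifferentiableAt_extChartAt_symm_of_mem {x : M} {z : EuclideanSpace ℝ (Fin d)}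
    (hz : z ∈ (extChartAt (𝓡 d) x).target) :
    MDifferentiableAt 𝓘(ℝ, EuclideanSpace ℝ (Fin d)) (𝓡 d) (extChartAt (𝓡 d) x).symm z := by
  have h := mdifferentiableWithinAt_extChartAt_symm (I := 𝓡 d) hz
  rwa [ModelWithCorners.range_eq_univ, mdifferentiableWithinAt_univ] at h

theorem fderiv_comp_extChartAt_symm {F : M → V} {x : M} {z : EuclideanSpace ℝ (Fin d)}
    (hz : z ∈ (extChartAt (𝓡 d) x).target)
    (hF : MDifferentiableAt (𝓡 d) 𝓘(ℝ, V) F ((extChartAt (𝓡 d) x).symm z))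
    (v : EuclideanSpace ℝ (Fin d)) :
    fderiv ℝ (F ∘ (extChartAt (𝓡 d) x).symm) z v =
      mvfderiv (𝓡 d) F ((extChartAt (𝓡 d) x).symm z)
        (mfderiv 𝓘(ℝ, EuclideanSpace ℝ (Fin d)) (𝓡 d) (extChartAt (𝓡 d) x).symm z v) := by
  have h := mfderiv_comp z hF (mdifferentiableAt_extChartAt_symm_of_mem hz)
  rw [← mfderiv_eq_fderiv, h]
  rfl

/-- The derivative along a Lie bracket is the commutator of the derivatives. -/
theorem mvfderiv_mlieBracket {F : M → V} {x : M} (hF : ContMDiffAt (𝓡 d) 𝓘(ℝ, V) ∞ F x)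
    {A C : ∀ x : M, TangentSpace (𝓡 d) x} (hA : SmoothFieldAt A x) (hC : SmoothFieldAt C x) :
    mvfderiv (𝓡 d) F x (VectorField.mlieBracket (𝓡 d) A C x) =
      mvfderiv (𝓡 d) (fun y => mvfderiv (𝓡 d) F y (C y)) x (A x)
        - mvfderiv (𝓡 d) (fun y => mvfderiv (𝓡 d) F y (A y)) x (C x) := by
  have h2le : (2 : WithTop ℕ∞) ≤ ∞ := ENat.LEInfty.out
  set φ := extChartAt (𝓡 d) x with hφ
  have hmem : φ x ∈ φ.target := mem_extChartAt_target x
  have hinv : φ.symm (φ x) = x := extChartAt_to_inv x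
  have hrange : Set.range (𝓡 d) = univ := ModelWithCorners.range_eq_univ _
  let pb (A : ∀ x : M, TangentSpace (𝓡 d) x) (z : EuclideanSpace ℝ (Fin d)) :
      EuclideanSpace ℝ (Fin d) :=
    (mfderiv 𝓘(ℝ, EuclideanSpace ℝ (Fin d)) (𝓡 d) φ.symm z).inverse (A (φ.symm z))
  have hpb : ∀ A : (∀ x : M, TangentSpace (𝓡 d) x), VectorField.mpullbackWithin
      𝓘(ℝ, EuclideanSpace ℝ (Fin d)) (𝓡 d) φ.symm A univ = pb A := by
    intro A
    funext z
    simp only [VectorField.mpullbackWithin, mfderivWithin_univ, pb]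
  -- the derivative of `F` in the chart, at an arbitrary point of the chart
  have hder : ∀ (G : M → V) (z), z ∈ φ.target → MDifferentiableAt (𝓡 d) 𝓘(ℝ, V) G (φ.symm z) →
      ∀ A : (∀ x : M, TangentSpace (𝓡 d) x),
      fderiv ℝ (G ∘ φ.symm) z (pb A z) = mvfderiv (𝓡 d) G (φ.symm z) (A (φ.symm z)) := by
    intro G z hz hG A
    rw [fderiv_comp_extChartAt_symm hz hG]
    have hI := isInvertible_mfderivWithin_extChartAt_symm (I := 𝓡 d) hz
    rw [hrange, mfderivWithin_univ] at hI
    congr 1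
    exact hI.self_apply_inverse _
  have hdiff : ∀ A : (∀ x : M, TangentSpace (𝓡 d) x), SmoothFieldAt A x →
      DifferentiableAt ℝ (pb A) (φ x) := by
    intro A hA
    have h := MDifferentiableWithinAt.differentiableWithinAt_mpullbackWithin_vectorField
      (hA.mdifferentiableAt.mdifferentiableWithinAt (s := univ))
    rw [hrange, preimage_univ, univ_inter, ← hφ, hpb] at h
    exact h.differentiableAt univ_mem
  have hF' : ContDiffAt ℝ ∞ (F ∘ φ.symm) (φ x) := by
    have h := (contMDiffAt_iff.1 hF).2
    rw [hrange] at h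
    exact h.contDiffAt univ_mem
  have hnear : ∀ᶠ z in 𝓝 (φ x), z ∈ φ.target ∧ MDifferentiableAt (𝓡 d) 𝓘(ℝ, V) F (φ.symm z) := by
    have h1 : ∀ᶠ y in 𝓝 x, MDifferentiableAt (𝓡 d) 𝓘(ℝ, V) F y := by
      have h2 : ContMDiffAt (𝓡 d) 𝓘(ℝ, V) 1 F x := hF.of_le (by norm_num)
      filter_upwards [(contMDiffAt_iff_contMDiffAt_nhds (by simp)).1 h2] with y hy
      exact hy.mdifferentiableAt (by simp)
    have h3 : Tendsto φ.symm (𝓝 (φ x)) (𝓝 x) := by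
      have := continuousAt_extChartAt_symm (I := 𝓡 d) x
      rw [ContinuousAt] at this
      rwa [← hφ, hinv] at this
    exact Filter.Eventually.and (extChartAt_target_mem_nhds (I := 𝓡 d) x) (h3.eventually h1)
  have hG : ∀ A : (∀ x : M, TangentSpace (𝓡 d) x),
      (fun z => fderiv ℝ (F ∘ φ.symm) z (pb A z)) =ᶠ[𝓝 (φ x)]
        (fun y => mvfderiv (𝓡 d) F y (A y)) ∘ φ.symm := by
    intro A
    filter_upwards [hnear] with z hz
    exact hder F z hz.1 hz.2 A
  have hbr : mvfderiv (𝓡 d) F x (VectorField.mlieBracket (𝓡 d) A C x) =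
      fderiv ℝ (F ∘ φ.symm) (φ x) (VectorField.lieBracket ℝ (pb A) (pb C) (φ x)) := by
    have hFd : MDifferentiableAt 𝓘(ℝ, EuclideanSpace ℝ (Fin d)) 𝓘(ℝ, V) (F ∘ φ.symm) (φ x) :=
      (hF'.differentiableAt (by simp)).mdifferentiableAt
    have hφd : MDifferentiableAt (𝓡 d) 𝓘(ℝ, EuclideanSpace ℝ (Fin d)) φ x :=
      mdifferentiableAt_extChartAt (mem_chart_source _ x)
    have hcomp : mfderiv (𝓡 d) 𝓘(ℝ, V) F x = mfderiv (𝓡 d) 𝓘(ℝ, V) ((F ∘ φ.symm) ∘ φ) x := by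
      refine Filter.EventuallyEq.mfderiv_eq ?_
      filter_upwards [extChartAt_source_mem_nhds (I := 𝓡 d) x] with y hy
      simp only [comp_apply]
      rw [φ.left_inv hy]
    have hinvφ := isInvertible_mfderiv_extChartAt (I := 𝓡 d) (mem_extChartAt_source (I := 𝓡 d) x)
    have hbk : mfderiv (𝓡 d) 𝓘(ℝ, EuclideanSpace ℝ (Fin d)) φ x
        (VectorField.mlieBracket (𝓡 d) A C x) =
        VectorField.lieBracket ℝ (pb A) (pb C) (φ x) := by
      rw [← VectorField.mlieBracketWithin_univ, VectorField.mlieBracketWithin_apply]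
      rw [hrange, preimage_univ, univ_inter, ← hφ, hpb, hpb]
      refine (hinvφ.self_apply_inverse _).trans ?_
      rw [VectorField.lieBracketWithin_univ]
    have h3 : mfderiv (𝓡 d) 𝓘(ℝ, V) F x (VectorField.mlieBracket (𝓡 d) A C x) =
      mfderiv 𝓘(ℝ, EuclideanSpace ℝ (Fin d)) 𝓘(ℝ, V) (F ∘ φ.symm) (φ x)
        (mfderiv (𝓡 d) 𝓘(ℝ, EuclideanSpace ℝ (Fin d)) φ x
          (VectorField.mlieBracket (𝓡 d) A C x)) := by
      rw [hcomp, mfderiv_comp x hFd hφd]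
      rfl
    rw [hbk, mfderiv_eq_fderiv] at h3
    exact h3
  have h2 : ∀ A C : (∀ x : M, TangentSpace (𝓡 d) x), SmoothFieldAt A x → SmoothFieldAt C x →
      fderiv ℝ (fun z => fderiv ℝ (F ∘ φ.symm) z (pb C z)) (φ x) (pb A (φ x)) =
        mvfderiv (𝓡 d) (fun y => mvfderiv (𝓡 d) F y (C y)) x (A x) := by
    intro A C hA hC
    rw [(hG C).fderiv_eq, hder _ _ hmem]
    · rw [hinv]
    · rw [hinv]
      exact (contMDiffAt_mvfderiv_apply hF hC).mdifferentiableAt (by simp)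
  rw [hbr, VectorField.fderiv_apply_lieBracket hF' (by simpa using h2le) (hdiff C hC) (hdiff A hA),
    h2 A C hA hC, h2 C A hC hA]

end General

/-! ### Related vector fields and smooth coefficients -/

section General

variable {d e : ℕ} {M : Type*} [TopologicalSpace M] [ChartedSpace (EuclideanSpace ℝ (Fin d)) M]
  [IsManifold (𝓡 d) ∞ M]
  {N : Type*} [TopologicalSpace N] [ChartedSpace (EuclideanSpace ℝ (Fin e)) N]
  [IsManifold (𝓡 e) ∞ N]
  {V : Type*} [NormedAddCommGroup V] [NormedSpace ℝ V]

omit [IsManifold (𝓡 d) ∞ M] in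
theorem mvfderiv_congr_of_eventuallyEq {F G : M → V} {x : M} (h : F =ᶠ[𝓝 x] G) :
    mvfderiv (𝓡 d) F x = mvfderiv (𝓡 d) G x := by
  ext v
  exact congrArg (fun L : EuclideanSpace ℝ (Fin d) →L[ℝ] V => L v) h.mfderiv_eq

/-- The Lie bracket of vector fields related by a smooth map. -/
theorem mfderiv_mlieBracket_of_related {f : M → N} {x : M}
    (hf : ContMDiff (𝓡 d) (𝓡 e) ∞ f)
    {A C : ∀ x : M, TangentSpace (𝓡 d) x} {X Y : ∀ y : N, TangentSpace (𝓡 e) y}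
    (hA : SmoothFieldAt A x) (hC : SmoothFieldAt C x)
    (hX : SmoothFieldAt X (f x)) (hY : SmoothFieldAt Y (f x))
    (hAX : ∀ y, mfderiv (𝓡 d) (𝓡 e) f y (A y) = X (f y))
    (hCY : ∀ y, mfderiv (𝓡 d) (𝓡 e) f y (C y) = Y (f y)) :
    mfderiv (𝓡 d) (𝓡 e) f x (VectorField.mlieBracket (𝓡 d) A C x) =
      VectorField.mlieBracket (𝓡 e) X Y (f x) := by
  set φ := extChartAt (𝓡 e) (f x) with hφ
  have hφs : ContMDiffAt (𝓡 e) 𝓘(ℝ, EuclideanSpace ℝ (Fin e)) ∞ φ (f x) := contMDiffAt_extChartAt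
  have hcomp : ContMDiffAt (𝓡 d) 𝓘(ℝ, EuclideanSpace ℝ (Fin e)) ∞ (φ ∘ f) x :=
    hφs.comp x hf.contMDiffAt
  have hφd : ∀ᶠ y in 𝓝 (f x), MDifferentiableAt (𝓡 e) 𝓘(ℝ, EuclideanSpace ℝ (Fin e)) φ y := by
    filter_upwards [chart_source_mem_nhds (EuclideanSpace ℝ (Fin e)) (f x)] with y hy
    exact mdifferentiableAt_extChartAt hy
  have hfd : ∀ y, MDifferentiableAt (𝓡 d) (𝓡 e) f y := fun y =>
    hf.contMDiffAt.mdifferentiableAt (by simp)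
  have hchain : ∀ (g : N → EuclideanSpace ℝ (Fin e)) (y : M),
      MDifferentiableAt (𝓡 e) 𝓘(ℝ, EuclideanSpace ℝ (Fin e)) g (f y) →
      ∀ v, mvfderiv (𝓡 d) (g ∘ f) y v = mvfderiv (𝓡 e) g (f y) (mfderiv (𝓡 d) (𝓡 e) f y v) := by
    intro g y hg v
    simp only [mvfderiv]
    rw [mfderiv_comp y hg (hfd y)]
    rfl
  have hinj : Injective (mvfderiv (𝓡 e) φ (f x)) :=
    (isInvertible_mfderiv_extChartAt (I := 𝓡 e) (mem_extChartAt_source (I := 𝓡 e) (f x))).injective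
  apply hinj
  rw [← hchain φ x hφd.self_of_nhds, mvfderiv_mlieBracket hcomp hA hC,
    mvfderiv_mlieBracket hφs hX hY]
  have key : ∀ (A C : ∀ x : M, TangentSpace (𝓡 d) x) (X Y : ∀ y : N, TangentSpace (𝓡 e) y),
      SmoothFieldAt Y (f x) →
      (∀ y, mfderiv (𝓡 d) (𝓡 e) f y (A y) = X (f y)) →
      (∀ y, mfderiv (𝓡 d) (𝓡 e) f y (C y) = Y (f y)) →
      mvfderiv (𝓡 d) (fun y => mvfderiv (𝓡 d) (φ ∘ f) y (C y)) x (A x) =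
        mvfderiv (𝓡 e) (fun y => mvfderiv (𝓡 e) φ y (Y y)) (f x) (X (f x)) := by
    intro A C X Y hY hAX hCY
    have h1 : (fun y => mvfderiv (𝓡 d) (φ ∘ f) y (C y)) =ᶠ[𝓝 x]
        (fun y => mvfderiv (𝓡 e) φ y (Y y)) ∘ f := by
      filter_upwards [hf.continuous.continuousAt.eventually hφd] with y hy
      rw [hchain φ y hy, hCY]
      rfl
    rw [mvfderiv_congr_of_eventuallyEq h1, hchain, hAX]
    exact (contMDiffAt_mvfderiv_apply hφs hY).mdifferentiableAt (by simp)
  rw [key A C X Y hY hAX hCY, key C A Y X hX hCY hAX]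

omit [IsManifold (𝓡 d) ∞ M] in
/-- If finitely many smooth vector-valued functions span at a point, every smooth function is
near that point a combination of them with smooth coefficients. -/
theorem exists_contMDiffAt_coeff {ι : Type*} [Fintype ι] [FiniteDimensional ℝ V] {w : ι → M → V}
    {x : M} (hw : ∀ i, ContMDiffAt (𝓡 d) 𝓘(ℝ, V) ∞ (w i) x)
    (hspan : ∀ v : V, ∃ c : ι → ℝ, ∑ i, c i • w i x = v) {g : M → V}
    (hg : ContMDiffAt (𝓡 d) 𝓘(ℝ, V) ∞ g x) :
    ∃ a : ι → M → ℝ, (∀ i, ContMDiffAt (𝓡 d) 𝓘(ℝ, ℝ) ∞ (a i) x) ∧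
      ∀ᶠ y in 𝓝 x, ∑ i, a i y • w i y = g y := by
  classical
  let L : M → ((ι → ℝ) →L[ℝ] V) := fun y =>
    ∑ i, (ContinuousLinearMap.proj (R := ℝ) (φ := fun _ : ι => ℝ) i).smulRight (w i y)
  have hL : ∀ y c, L y c = ∑ i, c i • w i y := by
    intro y c
    simp [L]
  have hLs : ContMDiffAt (𝓡 d) 𝓘(ℝ, (ι → ℝ) →L[ℝ] V) ∞ L x := by
    refine ContMDiffAt.sum fun i _ => ?_
    exact ((ContinuousLinearMap.smulRightL ℝ (ι → ℝ) V
      (ContinuousLinearMap.proj (R := ℝ) (φ := fun _ : ι => ℝ) i)).contMDiff).contMDiffAt.comp x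
      (hw i)
  have hsurj : Surjective (L x) := fun v => by
    obtain ⟨c, hc⟩ := hspan v
    exact ⟨c, by rw [hL, hc]⟩
  obtain ⟨R, hR⟩ := (L x : (ι → ℝ) →ₗ[ℝ] V).exists_rightInverse_of_surjective
    (LinearMap.range_eq_top.2 hsurj)
  let R' : V →L[ℝ] (ι → ℝ) := LinearMap.toContinuousLinearMap R
  have hR' : ∀ v, L x (R' v) = v := fun v => LinearMap.congr_fun hR v
  let T : M → (V →L[ℝ] V) := fun y => (L y).comp R'
  have hT : ContMDiffAt (𝓡 d) 𝓘(ℝ, V →L[ℝ] V) ∞ T x := hLs.clm_comp contMDiffAt_const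
  have hTx : T x = (ContinuousLinearEquiv.refl ℝ V : V →L[ℝ] V) := by
    ext v
    exact hR' v
  have hinv : ContMDiffAt (𝓡 d) 𝓘(ℝ, V →L[ℝ] V) ∞ (fun y => (T y).inverse) x := by
    refine ContMDiffAt.comp (I' := 𝓘(ℝ, V →L[ℝ] V)) (g := ContinuousLinearMap.inverse) x ?_ hT
    rw [hTx]
    exact (contDiffAt_map_inverse _).contMDiffAt
  have hinvt : ∀ᶠ y in 𝓝 x, (T y).IsInvertible := by
    have h := (ContinuousLinearEquiv.isOpen (𝕜 := ℝ) (E := V) (F := V)).mem_nhds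
      (show T x ∈ Set.range ContinuousLinearEquiv.toContinuousLinearMap from ⟨_, hTx.symm⟩)
    filter_upwards [hT.continuousAt h] with y hy
    exact hy
  refine ⟨fun i y => R' ((T y).inverse (g y)) i, fun i => ?_, ?_⟩
  · have h1 : ContMDiffAt (𝓡 d) 𝓘(ℝ, V) ∞ (fun y => (T y).inverse (g y)) x := hinv.clm_apply hg
    exact ((ContinuousLinearMap.proj (R := ℝ) (φ := fun _ : ι => ℝ) i).comp
      R').contMDiff.contMDiffAt.comp x h1
  · filter_upwards [hinvt] with y hy
    rw [← hL]
    exact hy.self_apply_inverse (g y)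

end General

/-! ### Smooth vector fields -/

section General

variable {d : ℕ} {M : Type*} [TopologicalSpace M] [ChartedSpace (EuclideanSpace ℝ (Fin d)) M]
  [IsManifold (𝓡 d) ∞ M]
  {V : Type*} [NormedAddCommGroup V] [NormedSpace ℝ V]

theorem SmoothFieldAt.add {A C : ∀ x : M, TangentSpace (𝓡 d) x} {x : M}
    (hA : SmoothFieldAt A x) (hC : SmoothFieldAt C x) : SmoothFieldAt (fun y => A y + C y) x :=
  ContMDiffAt.add_section hA hC

theorem SmoothFieldAt.neg {A : ∀ x : M, TangentSpace (𝓡 d) x} {x : M}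
    (hA : SmoothFieldAt A x) : SmoothFieldAt (fun y => -A y) x :=
  ContMDiffAt.neg_section hA

theorem SmoothFieldAt.sub {A C : ∀ x : M, TangentSpace (𝓡 d) x} {x : M}
    (hA : SmoothFieldAt A x) (hC : SmoothFieldAt C x) : SmoothFieldAt (fun y => A y - C y) x :=
  ContMDiffAt.sub_section hA hC

theorem SmoothFieldAt.smul {a : M → ℝ} {A : ∀ x : M, TangentSpace (𝓡 d) x} {x : M}
    (ha : ContMDiffAt (𝓡 d) 𝓘(ℝ, ℝ) ∞ a x) (hA : SmoothFieldAt A x) :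
    SmoothFieldAt (fun y => a y • A y) x :=
  ContMDiffAt.smul_section ha hA

theorem smoothFieldAt_zero (x : M) : SmoothFieldAt (fun y : M => (0 : TangentSpace (𝓡 d) y)) x :=
  contMDiff_zeroSection ℝ (fun y : M => TangentSpace (𝓡 d) y) x

theorem SmoothFieldAt.sum {ι : Type*} {s : Finset ι} {A : ι → ∀ x : M, TangentSpace (𝓡 d) x}
    {x : M} (hA : ∀ i ∈ s, SmoothFieldAt (A i) x) : SmoothFieldAt (fun y => ∑ i ∈ s, A i y) x :=
  ContMDiffAt.sum_section hA

theorem SmoothFieldAt.congr {A C : ∀ x : M, TangentSpace (𝓡 d) x} {x : M}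
    (hA : SmoothFieldAt A x) (h : ∀ᶠ y in 𝓝 x, C y = A y) : SmoothFieldAt C x := by
  refine ContMDiffAt.congr_of_eventuallyEq hA ?_
  filter_upwards [h] with y hy
  rw [hy]

/-- Every tangent vector extends to a global smooth vector field. -/
theorem exists_smoothField_eq [T2Space M] [SecondCountableTopology M] (x : M)
    (v : TangentSpace (𝓡 d) x) :
    ∃ X : ∀ y : M, TangentSpace (𝓡 d) y, SmoothField X ∧ X x = v := by
  classical
  have : LocallyCompactSpace M := ChartedSpace.locallyCompactSpace (EuclideanSpace ℝ (Fin d)) M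
  let t : ∀ y : M, Set (TangentSpace (𝓡 d) y) := fun y => {w | ∀ h : y = x, w = h ▸ v}
  have hconv : ∀ y, Convex ℝ (t y) := by
    intro y
    by_cases h : y = x
    · subst h
      have : t y = {v} := by ext; simp [t]
      rw [this]
      exact convex_singleton v
    · have : t y = univ := by ext; simp [t, h]
      rw [this]
      exact convex_univ
  have hloc : ∀ y : M, ∃ U ∈ 𝓝 y, ∃ A : (∀ z : M, TangentSpace (𝓡 d) z),
      ContMDiffOn (𝓡 d) (𝓡 d).tangent (⊤ : ℕ∞) (fun z => (⟨z, A z⟩ : TangentBundle (𝓡 d) M)) U ∧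
        ∀ z ∈ U, A z ∈ t z := by
    intro y
    by_cases h : y = x
    · subst h
      obtain ⟨U, hU, hs⟩ :=
        FiberBundle.exists_contMDiffOn_extend (k := ∞) (𝓡 d) (EuclideanSpace ℝ (Fin d)) v
      refine ⟨U, hU, _, hs, ?_⟩
      rintro z - rfl
      simp
    · refine ⟨{x}ᶜ, isOpen_compl_singleton.mem_nhds h, fun z => 0,
        (contMDiff_zeroSection ℝ (fun y : M => TangentSpace (𝓡 d) y)).contMDiffOn, ?_⟩
      intro z hz h'
      exact absurd h' hz
  obtain ⟨s, hs⟩ := exists_contMDiffSection_forall_mem_convex_of_local (𝓡 d)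
    (fun y : M => TangentSpace (𝓡 d) y) t hconv hloc
  exact ⟨s, s.contMDiff, hs x rfl⟩

/-- A smooth vector field is near `x` a combination, with smooth coefficients, of any finite
family of smooth vector fields that spans the tangent space at `x`. -/
theorem exists_smoothField_coeff {ι : Type*} [Fintype ι] {W : ι → ∀ x : M, TangentSpace (𝓡 d) x}
    {x : M} (hW : ∀ i, SmoothFieldAt (W i) x)
    (hspan : ∀ v : TangentSpace (𝓡 d) x, ∃ c : ι → ℝ, ∑ i, c i • W i x = v)
    {A : ∀ x : M, TangentSpace (𝓡 d) x} (hA : SmoothFieldAt A x) :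
    ∃ a : ι → M → ℝ, (∀ i, ContMDiffAt (𝓡 d) 𝓘(ℝ, ℝ) ∞ (a i) x) ∧
      ∀ᶠ y in 𝓝 x, A y = ∑ i, a i y • W i y := by
  let t := trivializationAt (EuclideanSpace ℝ (Fin d)) (fun y : M => TangentSpace (𝓡 d) y) x
  have hx : x ∈ t.baseSet := FiberBundle.mem_baseSet_trivializationAt' x
  have hsec : ∀ A : (∀ x : M, TangentSpace (𝓡 d) x), SmoothFieldAt A x →
      ContMDiffAt (𝓡 d) 𝓘(ℝ, EuclideanSpace ℝ (Fin d)) ∞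
        (fun y => t.continuousLinearMapAt ℝ y (A y)) x := by
    intro A hA
    refine ((t.contMDiffAt_section_iff hx).1 hA).congr_of_eventuallyEq ?_
    filter_upwards [t.open_baseSet.mem_nhds hx] with y hy
    exact t.continuousLinearMapAt_apply_of_mem ℝ hy (A y)
  obtain ⟨a, ha, h⟩ := exists_contMDiffAt_coeff (fun i => hsec (W i) (hW i)) (fun v => by
    obtain ⟨c, hc⟩ := hspan (t.symmL ℝ x v)
    refine ⟨c, ?_⟩
    have := congrArg (t.continuousLinearMapAt ℝ x) hc
    rwa [t.continuousLinearMapAt_symmL hx, map_sum, Finset.sum_congr rfl fun i _ => map_smul _ _ _]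
      at this) (hsec A hA)
  refine ⟨a, ha, ?_⟩
  filter_upwards [h, t.open_baseSet.mem_nhds hx] with y hy hyt
  have := congrArg (t.symmL ℝ y) hy
  rw [t.symmL_continuousLinearMapAt hyt, map_sum] at this
  rw [← this]
  refine Finset.sum_congr rfl fun i _ => ?_
  rw [map_smul, t.symmL_continuousLinearMapAt hyt]

/-- A vector field is smooth when its image under a smooth, pointwise injective, vector-valued
1-form is smooth. -/
theorem smoothFieldAt_of_coframe [FiniteDimensional ℝ V]
    {θ : ∀ x : M, TangentSpace (𝓡 d) x →ₗ[ℝ] V} {x : M}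
    (hθ : ∀ A : (∀ x : M, TangentSpace (𝓡 d) x), SmoothFieldAt A x →
      ContMDiffAt (𝓡 d) 𝓘(ℝ, V) ∞ (fun y => θ y (A y)) x)
    (hinj : ∀ᶠ y in 𝓝 x, Injective (θ y)) (hsurj : Surjective (θ x))
    {A : ∀ x : M, TangentSpace (𝓡 d) x} (hA : ContMDiffAt (𝓡 d) 𝓘(ℝ, V) ∞ (fun y => θ y (A y)) x) :
    SmoothFieldAt A x := by
  let t := trivializationAt (EuclideanSpace ℝ (Fin d)) (fun y : M => TangentSpace (𝓡 d) y) x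
  have hx : x ∈ t.baseSet := FiberBundle.mem_baseSet_trivializationAt' x
  let b := (EuclideanSpace.basisFun (Fin d) ℝ).toBasis
  have hb : ∀ i, SmoothFieldAt (t.localFrame b i) x := fun i =>
    contMDiffAt_localFrame_of_mem ∞ t b i hx
  obtain ⟨a, ha, h⟩ := exists_contMDiffAt_coeff (fun i => hθ _ (hb i)) (fun v => by
    obtain ⟨u, rfl⟩ := hsurj v
    refine ⟨(t.basisAt b hx).repr u, ?_⟩
    conv_rhs => rw [← (t.basisAt b hx).sum_repr u]
    rw [map_sum]
    refine Finset.sum_congr rfl fun i _ => ?_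
    rw [map_smul, t.localFrame_apply_of_mem_baseSet b hx]) hA
  refine (SmoothFieldAt.sum (s := Finset.univ) fun i _ => (hb i).smul (ha i)).congr ?_
  filter_upwards [h, hinj] with y hy hi
  apply hi
  rw [← hy, map_sum]
  refine Finset.sum_congr rfl fun i _ => ?_
  rw [map_smul]

end General

/-! ### Differentials of immersions -/

section Immersion

variable {E E' H H' : Type*} [NormedAddCommGroup E] [NormedSpace ℝ E] [NormedAddCommGroup E']
  [NormedSpace ℝ E'] [TopologicalSpace H] [TopologicalSpace H'] {I : ModelWithCorners ℝ E H}
  {J : ModelWithCorners ℝ E' H'} {M N : Type*} [TopologicalSpace M] [ChartedSpace H M]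
  [TopologicalSpace N] [ChartedSpace H' N]

/-- The differential of an immersion is injective. -/
theorem injective_mfderiv_of_isImmersionAt [I.Boundaryless] {f : M → N} {x : M}
    (hf : Manifold.IsImmersionAt I J ∞ f x) : Injective (mfderiv I J f x) := by
  have hdom := hf.domChart_mem_maximalAtlas
  have hcod := hf.codChart_mem_maximalAtlas
  have hx := hf.mem_domChart_source
  have hfd : MDifferentiableAt I J f x := hf.contMDiffAt.mdifferentiableAt (by simp)
  set φ := hf.domChart.extend I
  set ψ := hf.codChart.extend J
  have hφs : x ∈ φ.source := by simpa [φ] using hx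
  have hφx : φ x ∈ φ.target := φ.map_source hφs
  have hsymm : MDifferentiableAt 𝓘(ℝ, E) I φ.symm (φ x) := by
    have h := contMDiffOn_extend_symm hdom
    rw [← OpenPartialHomeomorph.extend_target'] at h
    exact (h.contMDiffAt (hf.domChart.isOpen_extend_target.mem_nhds hφx)).mdifferentiableAt
      (by simp)
  have hφd : MDifferentiableAt I 𝓘(ℝ, E) φ x :=
    (OpenPartialHomeomorph.contMDiffAt_extend hdom hx).mdifferentiableAt (by simp)
  have hψd : MDifferentiableAt J 𝓘(ℝ, E') ψ (f x) :=
    (OpenPartialHomeomorph.contMDiffAt_extend hcod hf.mem_codChart_source).mdifferentiableAt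
      (by simp)
  have hnhds : φ.source ∈ 𝓝 x := by
    simpa [φ] using hf.domChart.open_source.mem_nhds hx
  -- in the charts, `f` is the inclusion of a factor
  let L : E →L[ℝ] E' := (hf.equiv : (E × hf.complement) →L[ℝ] E').comp (.inl ℝ E hf.complement)
  have hloc : ψ ∘ f =ᶠ[𝓝 x] L ∘ φ := by
    filter_upwards [hnhds] with y hy
    have h := hf.writtenInCharts (φ.map_source hy)
    simp only [comp_apply] at h
    rw [φ.left_inv hy] at h
    exact h
  have h1 : (mfderiv J 𝓘(ℝ, E') ψ (f x)).comp (mfderiv I J f x) =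
      (L : E →L[ℝ] E').comp (mfderiv I 𝓘(ℝ, E) φ x) := by
    rw [← mfderiv_comp x hψd hfd, hloc.mfderiv_eq,
      mfderiv_comp x L.differentiableAt.mdifferentiableAt hφd, mfderiv_eq_fderiv, L.fderiv]
    rfl
  have hid : φ.symm ∘ φ =ᶠ[𝓝 x] id := by
    filter_upwards [hnhds] with y hy
    exact φ.left_inv hy
  have h2 : (mfderiv 𝓘(ℝ, E) I φ.symm (φ x)).comp (mfderiv I 𝓘(ℝ, E) φ x) =
      (ContinuousLinearMap.id ℝ E) := by
    rw [← mfderiv_comp x hsymm hφd, hid.mfderiv_eq, mfderiv_id]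
    rfl
  intro v w hvw
  have h3 : L (mfderiv I 𝓘(ℝ, E) φ x v) = L (mfderiv I 𝓘(ℝ, E) φ x w) := by
    have hv := congrArg (fun T : E →L[ℝ] E' => T v) h1
    have hw := congrArg (fun T : E →L[ℝ] E' => T w) h1
    refine hv.symm.trans (Eq.trans ?_ hw)
    exact congrArg (mfderiv J 𝓘(ℝ, E') ψ (f x)) hvw
  have h4 : mfderiv I 𝓘(ℝ, E) φ x v = mfderiv I 𝓘(ℝ, E) φ x w := by
    have h := hf.equiv.injective h3
    exact (Prod.ext_iff.1 h).1
  have hv := congrArg (fun T : E →L[ℝ] E => T v) h2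
  have hw := congrArg (fun T : E →L[ℝ] E => T w) h2
  exact hv.symm.trans ((congrArg (mfderiv 𝓘(ℝ, E) I φ.symm (φ x)) h4).trans hw)

end Immersion
/-! ### The Nijenhuis tensor -/

section General

variable {d : ℕ} {M : Type*} [TopologicalSpace M] [ChartedSpace (EuclideanSpace ℝ (Fin d)) M]
  [IsManifold (𝓡 d) ∞ M] {J : ∀ x : M, TangentSpace (𝓡 d) x → TangentSpace (𝓡 d) x}

theorem IsAlmostComplex.map_zero (hJ : IsAlmostComplex J) (x : M) : J x 0 = 0 := by
  simpa using hJ.map_smul x 0 0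

theorem IsAlmostComplex.map_neg (hJ : IsAlmostComplex J) (x : M) (v : TangentSpace (𝓡 d) x) :
    J x (-v) = -J x v := by
  simpa using hJ.map_smul x (-1) v

theorem IsAlmostComplex.map_sub (hJ : IsAlmostComplex J) (x : M) (v w : TangentSpace (𝓡 d) x) :
    J x (v - w) = J x v - J x w := by
  rw [sub_eq_add_neg, hJ.map_add, hJ.map_neg, ← sub_eq_add_neg]

theorem nijenhuis_swap (hJ : IsAlmostComplex J) (A C : ∀ x : M, TangentSpace (𝓡 d) x) (x : M) :
    nijenhuis J A C x = -nijenhuis J C A x := by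
  simp only [nijenhuis]
  rw [VectorField.mlieBracket_swap_apply (V := A) (W := C),
    VectorField.mlieBracket_swap_apply (V := fun y => J y (A y)) (W := C),
    VectorField.mlieBracket_swap_apply (V := A) (W := fun y => J y (C y)),
    VectorField.mlieBracket_swap_apply (V := fun y => J y (A y)) (W := fun y => J y (C y)),
    hJ.map_neg, hJ.map_neg]
  abel

theorem nijenhuis_self (hJ : IsAlmostComplex J) (A : ∀ x : M, TangentSpace (𝓡 d) x) (x : M) :
    nijenhuis J A A x = 0 := by
  have h : (2 : ℝ) • nijenhuis J A A x = 0 := by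
    rw [two_smul]
    exact add_eq_zero_iff_eq_neg.2 (nijenhuis_swap hJ A A x)
  exact (smul_eq_zero.1 h).resolve_left two_ne_zero

omit [IsManifold (𝓡 d) ∞ M] in
theorem nijenhuis_congr {A A' C : ∀ x : M, TangentSpace (𝓡 d) x} {x : M}
    (h : ∀ᶠ y in 𝓝 x, A y = A' y) : nijenhuis J A C x = nijenhuis J A' C x := by
  have h' : (fun y => J y (A y)) =ᶠ[𝓝 x] fun y => J y (A' y) := by
    filter_upwards [h] with y hy
    rw [hy]
  have h : A =ᶠ[𝓝 x] A' := h
  simp only [nijenhuis]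
  have hbr : ∀ {A A' : ∀ x : M, TangentSpace (𝓡 d) x} (C), A =ᶠ[𝓝 x] A' →
      VectorField.mlieBracket (𝓡 d) A C x = VectorField.mlieBracket (𝓡 d) A' C x :=
    fun C h => h.mlieBracket_vectorField_eq EventuallyEq.rfl
  rw [hbr C h, hbr _ h, hbr C h', hbr _ h']

theorem nijenhuis_add (hJ : IsAlmostComplex J) {A A' C : ∀ x : M, TangentSpace (𝓡 d) x} {x : M}
    (hA : SmoothFieldAt A x) (hA' : SmoothFieldAt A' x) :
    nijenhuis J (fun y => A y + A' y) C x = nijenhuis J A C x + nijenhuis J A' C x := by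
  have hJA : (fun y => J y (A y + A' y)) = (fun y => J y (A y)) + (fun y => J y (A' y)) := by
    funext y
    exact hJ.map_add y _ _
  have hAA : (fun y => A y + A' y) = A + A' := rfl
  simp only [nijenhuis]
  rw [hJA, hAA, VectorField.mlieBracket_add_left hA.mdifferentiableAt hA'.mdifferentiableAt,
    VectorField.mlieBracket_add_left hA.mdifferentiableAt hA'.mdifferentiableAt,
    VectorField.mlieBracket_add_left (hJ.smooth A x hA).mdifferentiableAt
      (hJ.smooth A' x hA').mdifferentiableAt,
    VectorField.mlieBracket_add_left (hJ.smooth A x hA).mdifferentiableAt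
      (hJ.smooth A' x hA').mdifferentiableAt, hJ.map_add, hJ.map_add]
  abel

/-- `[J, J]` is linear over functions: the derivatives of the coefficient cancel. -/
theorem nijenhuis_smul (hJ : IsAlmostComplex J) {a : M → ℝ} {A C : ∀ x : M, TangentSpace (𝓡 d) x}
    {x : M} (ha : ContMDiffAt (𝓡 d) 𝓘(ℝ, ℝ) ∞ a x) (hA : SmoothFieldAt A x) :
    nijenhuis J (fun y => a y • A y) C x = a x • nijenhuis J A C x := by
  have had := ha.mdifferentiableAt (by simp)
  have hJA : (fun y => J y (a y • A y)) = a • (fun y => J y (A y)) := by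
    funext y
    exact hJ.map_smul y _ _
  have hAA : (fun y => a y • A y) = a • A := rfl
  simp only [nijenhuis]
  rw [hJA, hAA, VectorField.mlieBracket_smul_left had hA.mdifferentiableAt,
    VectorField.mlieBracket_smul_left had hA.mdifferentiableAt,
    VectorField.mlieBracket_smul_left had (hJ.smooth A x hA).mdifferentiableAt,
    VectorField.mlieBracket_smul_left had (hJ.smooth A x hA).mdifferentiableAt,
    hJ.map_add, hJ.map_add, hJ.map_smul, hJ.map_smul, hJ.map_smul, hJ.map_smul, hJ.square]
  module

theorem nijenhuis_sum (hJ : IsAlmostComplex J) {ι : Type*} (s : Finset ι)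
    {A : ι → ∀ x : M, TangentSpace (𝓡 d) x} {C : ∀ x : M, TangentSpace (𝓡 d) x} {x : M}
    (hA : ∀ i ∈ s, SmoothFieldAt (A i) x) :
    nijenhuis J (fun y => ∑ i ∈ s, A i y) C x = ∑ i ∈ s, nijenhuis J (A i) C x := by
  classical
  induction s using Finset.induction_on with
  | empty =>
    have := nijenhuis_smul hJ (a := fun _ => 0) (C := C) contMDiffAt_const (smoothFieldAt_zero x)
    simpa using this
  | insert i s hi ih =>
    simp only [Finset.sum_insert hi]
    rw [nijenhuis_add hJ (hA i (Finset.mem_insert_self i s))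
      (SmoothFieldAt.sum fun j hj => hA j (Finset.mem_insert_of_mem hj)),
      ih fun j hj => hA j (Finset.mem_insert_of_mem hj)]

/-- `[J, J]` vanishes when it vanishes on a family of fields spanning each tangent space. -/
theorem isIntegrable_of_frame (hJ : IsAlmostComplex J) {ι : Type*} [Fintype ι]
    (hW : ∀ x : M, ∃ W : ι → ∀ x : M, TangentSpace (𝓡 d) x, (∀ i, SmoothFieldAt (W i) x) ∧
      (∀ v : TangentSpace (𝓡 d) x, ∃ c : ι → ℝ, ∑ i, c i • W i x = v) ∧
      ∀ i j, nijenhuis J (W i) (W j) x = 0) : IsIntegrable J := by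
  intro A C x hA hC
  obtain ⟨W, hW, hspan, hN⟩ := hW x
  have step : ∀ (A C : ∀ x : M, TangentSpace (𝓡 d) x), SmoothFieldAt A x →
      (∀ i, nijenhuis J (W i) C x = 0) → nijenhuis J A C x = 0 := by
    intro A C hA h0
    obtain ⟨a, ha, h⟩ := exists_smoothField_coeff hW hspan hA
    rw [nijenhuis_congr h, nijenhuis_sum hJ _ fun i _ => (hW i).smul (ha i)]
    refine Finset.sum_eq_zero fun i _ => ?_
    rw [nijenhuis_smul hJ (ha i) (hW i), h0, smul_zero]
  refine step A C hA fun i => ?_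
  rw [nijenhuis_swap hJ, step C (W i) hC fun j => hN j i, neg_zero]

end General

/-! ### Linear algebra -/

section LinearAlgebra

/-- The elements of a fibre product of vector spaces are attained by a map that is injective, if
the dimensions fit. -/
theorem exists_eq_and_eq_of_finrank {T U W Z : Type*} [AddCommGroup T] [Module ℝ T]
    [AddCommGroup U] [Module ℝ U] [AddCommGroup W] [Module ℝ W] [AddCommGroup Z] [Module ℝ Z]
    [FiniteDimensional ℝ T] [FiniteDimensional ℝ U] [FiniteDimensional ℝ W]
    [FiniteDimensional ℝ Z] (f : T →ₗ[ℝ] U) (g : T →ₗ[ℝ] W) (a : U →ₗ[ℝ] Z) (h : W →ₗ[ℝ] Z)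
    (hh : Surjective h) (hc : ∀ t, a (f t) = h (g t)) (hinj : ∀ t, f t = 0 → g t = 0 → t = 0)
    (hdim : finrank ℝ T + finrank ℝ Z = finrank ℝ U + finrank ℝ W) {u : U} {w : W}
    (huw : a u = h w) : ∃ t, f t = u ∧ g t = w := by
  let δ : U × W →ₗ[ℝ] Z := a.coprod (-h)
  have hδ : Surjective δ := fun z => by
    obtain ⟨w, hw⟩ := hh (-z)
    exact ⟨(0, w), by simp [δ, hw]⟩
  have h1 := δ.finrank_range_add_finrank_ker
  rw [LinearMap.range_eq_top.2 hδ, finrank_top, finrank_prod] at h1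
  have hfg : Injective (f.prod g) := by
    rw [← LinearMap.ker_eq_bot, LinearMap.ker_eq_bot']
    intro t ht
    exact hinj t (congrArg Prod.fst ht) (congrArg Prod.snd ht)
  have h2 := LinearMap.finrank_range_of_inj hfg
  have hle : LinearMap.range (f.prod g) ≤ LinearMap.ker δ := by
    rintro _ ⟨t, rfl⟩
    simp [δ, hc]
  have heq := Submodule.eq_of_le_of_finrank_eq hle (by omega)
  have hmem : (u, w) ∈ LinearMap.range (f.prod g) := by
    rw [heq]
    simp [δ, huw]
  obtain ⟨t, ht⟩ := hmem
  exact ⟨t, congrArg Prod.fst ht, congrArg Prod.snd ht⟩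

/-- The lift of vectors along a surjective linear map, orthogonally to its kernel, is linear. -/
theorem exists_orthogonal_lift {T W V : Type*} [AddCommGroup T] [Module ℝ T]
    [FiniteDimensional ℝ T] [AddCommGroup W] [Module ℝ W] [NormedAddCommGroup V]
    [InnerProductSpace ℝ V] (f : T →ₗ[ℝ] W) (j : T →ₗ[ℝ] V) (hf : Surjective f)
    (hj : ∀ t, f t = 0 → j t = 0 → t = 0) :
    ∃ l : W →ₗ[ℝ] T, ∀ w t, (f t = w ∧ ∀ s, f s = 0 → inner ℝ (j s) (j t) = 0) ↔ t = l w := by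
  have hex : ∀ w, ∃ t, f t = w ∧ ∀ s, f s = 0 → inner ℝ (j s) (j t) = 0 := by
    intro w
    obtain ⟨t, rfl⟩ := hf w
    let K := (LinearMap.ker f).map j
    obtain ⟨k, hk, hk'⟩ := (Submodule.mem_map).1 (K.starProjection_apply_mem (j t))
    refine ⟨t - k, by simp [LinearMap.mem_ker.1 hk], fun s hs => ?_⟩
    rw [map_sub, hk']
    exact Submodule.inner_right_of_mem_orthogonal (K := K)
      (Submodule.mem_map_of_mem (LinearMap.mem_ker.2 hs)) (K.sub_starProjection_mem_orthogonal _)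
  have huniq : ∀ t t', f t = f t' → (∀ s, f s = 0 → inner ℝ (j s) (j t) = 0) →
      (∀ s, f s = 0 → inner ℝ (j s) (j t') = 0) → t = t' := by
    intro t t' h h1 h2
    have h0 : f (t - t') = 0 := by rw [map_sub, h, sub_self]
    refine sub_eq_zero.1 (hj _ h0 ?_)
    rw [← inner_self_eq_zero (𝕜 := ℝ)]
    nth_rw 2 [map_sub]
    rw [inner_sub_right, h1 _ h0, h2 _ h0, sub_zero]
  choose l hl1 hl2 using hex
  refine ⟨⟨⟨l, fun v w => huniq _ _ ?_ (hl2 _) fun s hs => ?_⟩,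
      fun c w => huniq _ _ ?_ (hl2 _) fun s hs => ?_⟩,
    fun w t => ⟨fun h => ?_, ?_⟩⟩
  · rw [map_add, hl1, hl1, hl1]
  · rw [map_add, inner_add_right, hl2 _ s hs, hl2 _ s hs, add_zero]
  · rw [map_smul, hl1, hl1]
    rfl
  · rw [map_smul, inner_smul_right, hl2 _ s hs, mul_zero]
  · exact huniq _ _ (h.1.trans (hl1 w).symm) h.2 (hl2 w)
  · rintro rfl
    exact ⟨hl1 w, hl2 w⟩

end LinearAlgebra

/-! ### Quaternionic vectors -/

section Quaternions

variable {n : ℕ}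

theorem rmul_add (x : QSpace n) (p q : ℍ[ℝ]) : rmul x (p + q) = rmul x p + rmul x q := by
  ext a : 1
  simp [mul_add]

theorem rmul_smul (x : QSpace n) (c : ℝ) (q : ℍ[ℝ]) : rmul x (c • q) = c • rmul x q := by
  ext a : 1
  simp

theorem rmul_neg (x : QSpace n) (q : ℍ[ℝ]) : rmul x (-q) = -rmul x q := by
  ext a : 1
  simp

theorem rmul_one (x : QSpace n) : rmul x 1 = x := by
  ext a : 1
  simp

theorem rmul_rmul (x : QSpace n) (p q : ℍ[ℝ]) : rmul (rmul x p) q = rmul x (p * q) := by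
  ext a : 1
  simp [mul_assoc]

/-- Right multiplication by a fixed quaternion, as a continuous linear map. -/
def rmulL (n : ℕ) (q : ℍ[ℝ]) : QSpace n →L[ℝ] QSpace n :=
  LinearMap.toContinuousLinearMap
    { toFun := fun x => rmul x q
      map_add' := fun x y => by ext a : 1; simp [add_mul]
      map_smul' := fun c x => by ext a : 1; simp }

theorem inner_rmul_rmul_self (x : QSpace n) (p q : ℍ[ℝ]) :
    inner ℝ (rmul x p) (rmul x q) = ‖x‖ ^ 2 * inner ℝ p q := by
  rw [PiLp.norm_sq_eq_of_L2, PiLp.inner_apply, Finset.sum_mul]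
  refine Finset.sum_congr rfl fun a _ => ?_
  rw [← real_inner_self_eq_norm_sq]
  simp only [rmul_apply, Quaternion.inner_def, Quaternion.re_mul, Quaternion.imI_mul,
    Quaternion.imJ_mul, Quaternion.imK_mul, Quaternion.re_star, Quaternion.imI_star,
    Quaternion.imJ_star, Quaternion.imK_star]
  ring

/-- Right multiplication by an imaginary quaternion is skew. -/
theorem inner_rmul_left {q : ℍ[ℝ]} (hq : q.re = 0) (v w : QSpace n) :
    inner ℝ (rmul v q) w = -inner ℝ v (rmul w q) := by
  rw [PiLp.inner_apply, PiLp.inner_apply, ← Finset.sum_neg_distrib]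
  refine Finset.sum_congr rfl fun a _ => ?_
  simp only [rmul_apply, Quaternion.inner_def, Quaternion.re_mul, Quaternion.imI_mul,
    Quaternion.imJ_mul, Quaternion.imK_mul, Quaternion.re_star, Quaternion.imI_star,
    Quaternion.imJ_star, Quaternion.imK_star, hq]
  ring

theorem inner_rmul_self {q : ℍ[ℝ]} (hq : q.re = 0) (x : QSpace n) :
    inner ℝ x (rmul x q) = 0 := by
  have h := inner_rmul_rmul_self x 1 q
  rw [rmul_one] at h
  rw [h]
  simp [Quaternion.inner_def, hq]

end Quaternions

/-! ### The differential of the Hopf map -/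

section Hopf

variable {n : ℕ}

/-- The affine coordinates as a function on the ambient vector space. -/
def ambientCoord (k : Fin (n + 1)) (y : QSpace n) (i : Fin n) : ℍ[ℝ] :=
  y (k.succAbove i) * (y k)⁻¹

theorem contDiffAt_ambientCoord {k : Fin (n + 1)} {y : QSpace n} (hy : y k ≠ 0) :
    ContDiffAt ℝ ∞ (ambientCoord k) y := by
  have hc : ∀ a, ContDiff ℝ ∞ fun y : QSpace n => y a := fun a =>
    (contDiff_piLp 2).1 contDiff_id a
  exact contDiffAt_pi.2 fun i => (hc _).contDiffAt.mul
    (ContDiffAt.comp y (contDiffAt_quaternion_inv hy) (hc k).contDiffAt)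

theorem fderiv_ambientCoord_eq_of_hasDerivAt {k : Fin (n + 1)} {y : QSpace n} (hy : y k ≠ 0)
    {w : QSpace n} {τ : Fin n → ℍ[ℝ]}
    (h : HasDerivAt (fun t : ℝ => ambientCoord k (y + t • w)) τ 0) :
    fderiv ℝ (ambientCoord k) y w = τ := by
  have h1 : HasFDerivAt (ambientCoord k) (fderiv ℝ (ambientCoord k) y) y :=
    ((contDiffAt_ambientCoord hy).differentiableAt (by simp)).hasFDerivAt
  exact (h1.hasLineDerivAt w).unique h

/-- Affine coordinates are constant in the direction of the quaternionic line of `y`. -/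
theorem fderiv_ambientCoord_rmul {k : Fin (n + 1)} {y : QSpace n} (hy : y k ≠ 0) (q : ℍ[ℝ]) :
    fderiv ℝ (ambientCoord k) y (rmul y q) = 0 := by
  refine fderiv_ambientCoord_eq_of_hasDerivAt hy ?_
  refine (hasDerivAt_const (0 : ℝ) (ambientCoord k y)).congr_of_eventuallyEq ?_
  have hne : ∀ᶠ t : ℝ in 𝓝 0, (1 + t • q : ℍ[ℝ]) ≠ 0 := by
    have hc : Continuous fun t : ℝ => (1 + t • q : ℍ[ℝ]) := by fun_prop
    exact hc.continuousAt.eventually_ne (by simp)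
  filter_upwards [hne] with t ht
  funext i
  simp only [ambientCoord]
  have : ∀ a, (y + t • rmul y q) a = y a * (1 + t • q) := by
    intro a
    simp [mul_add]
  rw [this, this, mul_inv_rev, mul_assoc, mul_inv_cancel_left₀ ht]

theorem exists_fderiv_ambientCoord_eq {k : Fin (n + 1)} {y : QSpace n} (hy : y k ≠ 0)
    (τ : Fin n → ℍ[ℝ]) : ∃ w, fderiv ℝ (ambientCoord k) y w = τ := by
  let w : QSpace n := WithLp.toLp 2 (k.insertNth (α := fun _ => ℍ[ℝ]) 0 fun i => τ i * y k)
  have hwk : w k = 0 := by simp [w]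
  have hwi : ∀ i, w (k.succAbove i) = τ i * y k := by simp [w]
  refine ⟨w, fderiv_ambientCoord_eq_of_hasDerivAt hy ?_⟩
  have h : (fun t : ℝ => ambientCoord k (y + t • w)) = fun t => ambientCoord k y + t • τ := by
    funext t i
    simp only [ambientCoord, Pi.add_apply, Pi.smul_apply, PiLp.add_apply, PiLp.smul_apply, hwk, hwi,
      smul_zero, add_zero, add_mul, smul_mul_assoc, mul_assoc, mul_inv_cancel₀ hy, mul_one]
  rw [h]
  simpa using ((hasDerivAt_id (0 : ℝ)).smul_const τ).const_add (ambientCoord k y)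

/-- The inclusion of the sphere. -/
def sphereIncl (x : S n) : TangentSpace (𝓡 (4 * n + 3)) x →L[ℝ] QSpace n :=
  mvfderiv (𝓡 (4 * n + 3)) (fun y : S n => (y : QSpace n)) x

theorem sphereIncl_injective (x : S n) : Injective (sphereIncl x) :=
  injective_mvfderiv_subtypeVal_sphere x

theorem exists_sphereIncl_eq (x : S n) {w : QSpace n} (hw : inner ℝ (x : QSpace n) w = 0) :
    ∃ t, sphereIncl x t = w := by
  have h : w ∈ (sphereIncl x).range := by
    have := range_mvfderiv_subtypeVal (n := 4 * n + 3) x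
    rw [sphereIncl, this]
    exact Submodule.mem_orthogonal_singleton_iff_inner_right.2 hw
  exact h

theorem exists_chartAt_hopf (x : S n) : ∃ k : Fin (n + 1), (x : QSpace n) k ≠ 0 ∧
    chartAt (Fin n → ℍ[ℝ]) (hopf x) = affineChart k := by
  refine ⟨(exists_coordNorm_ne_zero (hopf x)).choose, ?_, rfl⟩
  have h := (exists_coordNorm_ne_zero (hopf x)).choose_spec
  intro h0
  apply h
  change ‖(x : QSpace n) _‖ = 0
  rw [h0, norm_zero]

theorem contMDiff_hopf : ContMDiff (𝓡 (4 * n + 3)) 𝓘(ℝ, Fin n → ℍ[ℝ]) ∞ (hopf (n := n)) := by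
  intro x
  obtain ⟨k, hk, hchart⟩ := exists_chartAt_hopf x
  rw [contMDiffAt_iff_target]
  refine ⟨(isQuotientMap_hopf n).continuous.continuousAt, ?_⟩
  have h : extChartAt 𝓘(ℝ, Fin n → ℍ[ℝ]) (hopf x) ∘ hopf =
      ambientCoord k ∘ fun y : S n => (y : QSpace n) := by
    funext y
    simp only [extChartAt, hchart]
    rfl
  rw [h]
  exact (contDiffAt_ambientCoord hk).contMDiffAt.comp x contMDiff_coe_sphere.contMDiffAt

/-- In an affine chart, the differential of the Hopf map is that of the affine coordinates. -/
theorem exists_dHopf_eq (x : S n) : ∃ k : Fin (n + 1), (x : QSpace n) k ≠ 0 ∧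
    ∃ L : TangentSpace 𝓘(ℝ, Fin n → ℍ[ℝ]) (hopf x) →L[ℝ] (Fin n → ℍ[ℝ]), Bijective L ∧
      ∀ t, L (dHopf x t) = fderiv ℝ (ambientCoord k) x (sphereIncl x t) := by
  obtain ⟨k, hk, hchart⟩ := exists_chartAt_hopf x
  refine ⟨k, hk, mfderiv 𝓘(ℝ, Fin n → ℍ[ℝ]) 𝓘(ℝ, Fin n → ℍ[ℝ])
    (extChartAt 𝓘(ℝ, Fin n → ℍ[ℝ]) (hopf x)) (hopf x),
    (isInvertible_mfderiv_extChartAt (mem_extChartAt_source (I := 𝓘(ℝ, Fin n → ℍ[ℝ])) _)).bijective,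
    fun t => ?_⟩
  have h : extChartAt 𝓘(ℝ, Fin n → ℍ[ℝ]) (hopf x) ∘ hopf =
      ambientCoord k ∘ fun y : S n => (y : QSpace n) := by
    funext y
    simp only [extChartAt, hchart]
    rfl
  have h1 : mfderiv (𝓡 (4 * n + 3)) 𝓘(ℝ, Fin n → ℍ[ℝ])
      (extChartAt 𝓘(ℝ, Fin n → ℍ[ℝ]) (hopf x) ∘ hopf) x =
      mfderiv (𝓡 (4 * n + 3)) 𝓘(ℝ, Fin n → ℍ[ℝ])
        (ambientCoord k ∘ fun y : S n => (y : QSpace n)) x := by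
    rw [h]
  rw [mfderiv_comp x (mdifferentiableAt_extChartAt (mem_chart_source _ _))
      (contMDiff_hopf.contMDiffAt.mdifferentiableAt (by simp)),
    mfderiv_comp x ((contDiffAt_ambientCoord hk).differentiableAt (by simp)).mdifferentiableAt
      (contMDiff_coe_sphere.contMDiffAt.mdifferentiableAt (n := ∞) (by simp)),
    mfderiv_eq_fderiv] at h1
  exact congrArg (fun L : EuclideanSpace ℝ (Fin (4 * n + 3)) →L[ℝ] (Fin n → ℍ[ℝ]) => L t) h1

theorem dHopf_surjective (x : S n) : Surjective (dHopf x) := by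
  obtain ⟨k, hk, L, hL, h⟩ := exists_dHopf_eq x
  intro v
  obtain ⟨w, hw⟩ := exists_fderiv_ambientCoord_eq hk (L v)
  have hx : ‖(x : QSpace n)‖ = 1 := by simp
  obtain ⟨t, ht⟩ := exists_sphereIncl_eq x
    (w := w - (inner ℝ (x : QSpace n) w) • rmul (x : QSpace n) 1) (by
      rw [rmul_one, inner_sub_right, inner_smul_right, real_inner_self_eq_norm_sq, hx]
      ring)
  refine ⟨t, hL.1 ?_⟩
  rw [h, ht, map_sub, map_smul, fderiv_ambientCoord_rmul hk, hw, smul_zero, sub_zero]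

/-- The vectors `x q` are tangent to the Hopf fibres. -/
theorem dHopf_eq_zero {x : S n} {t : TangentSpace (𝓡 (4 * n + 3)) x} {q : ℍ[ℝ]}
    (ht : sphereIncl x t = rmul (x : QSpace n) q) : dHopf x t = 0 := by
  obtain ⟨k, hk, L, hL, h⟩ := exists_dHopf_eq x
  apply hL.1
  rw [h, ht, fderiv_ambientCoord_rmul hk, map_zero]

/-- The metric of quaternionic projective space is pointwise induced by an injective linear map
into a Euclidean space. -/
theorem exists_hpMetric_eq_inner (z : HP n) :
    ∃ l : TangentSpace 𝓘(ℝ, Fin n → ℍ[ℝ]) z →ₗ[ℝ] QSpace n, Injective l ∧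
      ∀ v w, hpMetric z v w = inner ℝ (l v) (l w) := by
  let x := Quotient.out z
  have : FiniteDimensional ℝ (TangentSpace (𝓡 (4 * n + 3)) x) :=
    inferInstanceAs (FiniteDimensional ℝ (EuclideanSpace ℝ (Fin (4 * n + 3))))
  obtain ⟨l, hl⟩ := exists_orthogonal_lift (dHopf x).toLinearMap (sphereIncl x).toLinearMap
    (dHopf_surjective x) (fun t _ h => sphereIncl_injective x (by simpa using h))
  have hlift : ∀ v, hopfLift x v = l v := fun v =>
    (hl v _).1 (Classical.epsilon_spec (p := fun t => dHopf x t = v ∧ ∀ s, dHopf x s = 0 →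
      sphereMetric x s t = 0) ⟨l v, (hl v _).2 rfl⟩)
  have hinj : Injective l := by
    intro v w hvw
    have h1 := ((hl v _).2 rfl).1
    have h2 := ((hl w _).2 rfl).1
    rw [← h1, ← h2, hvw]
  have hcast : ∀ (y z : HP n) (h : y = z), ∃ c : TangentSpace 𝓘(ℝ, Fin n → ℍ[ℝ]) z →ₗ[ℝ]
      TangentSpace 𝓘(ℝ, Fin n → ℍ[ℝ]) y, Injective c ∧ ∀ v, c v = h.symm ▸ v := by
    rintro y z rfl
    exact ⟨LinearMap.id, injective_id, fun _ => rfl⟩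
  obtain ⟨c, hc, hcv⟩ := hcast _ _ (hopf_out z)
  refine ⟨(sphereIncl x).toLinearMap ∘ₗ l ∘ₗ c,
    (sphereIncl_injective x).comp (hinj.comp hc), fun v w => ?_⟩
  simp only [hpMetric, ← hcv]
  rw [show hopfLift (Quotient.out z) (c v) = l (c v) from hlift (c v),
    show hopfLift (Quotient.out z) (c w) = l (c w) from hlift (c w)]
  rfl

end Hopf

/-! ### Quaternion triples -/

section Triple

variable {u : Fin 3 → ℍ[ℝ]}

theorem mul_self_of_re_eq_zero {q : ℍ[ℝ]} (h0 : q.re = 0) (h1 : ‖q‖ = 1) : q * q = -1 := by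
  have h : star q = -q := by
    ext <;> simp [h0]
  have h2 := Quaternion.self_mul_star q
  rw [h, Quaternion.normSq_eq_norm_mul_self, h1] at h2
  simpa [neg_eq_iff_eq_neg] using h2

theorem IsQuaternionTriple.mul_self (hu : IsQuaternionTriple u) (a : Fin 3) : u a * u a = -1 :=
  mul_self_of_re_eq_zero (hu.re_eq_zero a) (hu.norm_eq_one a)

theorem IsQuaternionTriple.mul_one_zero (hu : IsQuaternionTriple u) : u 1 * u 0 = -u 2 := by
  have hs : ∀ a, star (u a) = -u a := fun a => by
    ext <;> simp [hu.re_eq_zero a]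
  have h := congrArg star hu.mul_eq
  rw [star_mul, hs, hs, hs, neg_mul_neg] at h
  exact h

theorem IsQuaternionTriple.mul_one_two (hu : IsQuaternionTriple u) : u 1 * u 2 = u 0 := by
  have h : u 2 = -(u 1 * u 0) := by rw [hu.mul_one_zero, neg_neg]
  rw [h, mul_neg, ← mul_assoc, hu.mul_self]
  simp

theorem IsQuaternionTriple.mul_two_one (hu : IsQuaternionTriple u) : u 2 * u 1 = -u 0 := by
  rw [← hu.mul_eq, mul_assoc, hu.mul_self]
  simp

theorem IsQuaternionTriple.mul_zero_two (hu : IsQuaternionTriple u) : u 0 * u 2 = -u 1 := by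
  rw [← hu.mul_eq, ← mul_assoc, hu.mul_self]
  simp

theorem IsQuaternionTriple.mul_two_zero (hu : IsQuaternionTriple u) : u 2 * u 0 = u 1 := by
  have h : u 2 = -(u 1 * u 0) := by rw [hu.mul_one_zero, neg_neg]
  rw [h, neg_mul, mul_assoc, hu.mul_self]
  simp

theorem IsQuaternionTriple.inner_eq (hu : IsQuaternionTriple u) (a b : Fin 3) :
    inner ℝ (u a) (u b) = if a = b then (1 : ℝ) else 0 := by
  have hs : ∀ a, star (u a) = -u a := fun a => by
    ext <;> simp [hu.re_eq_zero a]
  rw [Quaternion.inner_def, hs, mul_neg]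
  fin_cases a <;> fin_cases b <;>
    simp [hu.mul_self, hu.mul_eq, hu.mul_one_zero, hu.mul_one_two, hu.mul_two_one,
      hu.mul_zero_two, hu.mul_two_zero, hu.re_eq_zero]

end Triple

/-! ### Tangent spaces of the induced bundle -/

namespace InducedHopfBundle

variable {n m : ℕ} {B P : Type*}
  [TopologicalSpace B] [ChartedSpace (EuclideanSpace ℝ (Fin m)) B]
  [TopologicalSpace P] [ChartedSpace (EuclideanSpace ℝ (Fin (m + 3))) P]
  (D : InducedHopfBundle n m B P)

theorem contMDiff_proj : ContMDiff (𝓡 (m + 3)) (𝓡 m) ∞ D.proj :=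
  D.isSmoothEmbedding.contMDiff.fst

theorem contMDiff_toSphere : ContMDiff (𝓡 (m + 3)) (𝓡 (4 * n + 3)) ∞ D.toSphere :=
  D.isSmoothEmbedding.contMDiff.snd

theorem contMDiff_coe_toSphere :
    ContMDiff (𝓡 (m + 3)) 𝓘(ℝ, QSpace n) ∞ (fun p => (D.toSphere p : QSpace n)) :=
  contMDiff_coe_sphere.comp D.contMDiff_toSphere

theorem incl_proj (p : P) : D.incl (D.proj p) = hopf (D.toSphere p) := by
  have h : (D.proj p, D.toSphere p) ∈ {y : B × S n | D.incl y.1 = hopf y.2} :=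
    D.range_eq ▸ ⟨p, rfl⟩
  exact h

/-- The differential of the map to the sphere, with values in the tangent space of the sphere. -/
def dToSphere (p : P) :
    TangentSpace (𝓡 (m + 3)) p →L[ℝ] TangentSpace (𝓡 (4 * n + 3)) (D.toSphere p) :=
  mfderiv (𝓡 (m + 3)) (𝓡 (4 * n + 3)) D.toSphere p

theorem dSphere_eq (p : P) (v : TangentSpace (𝓡 (m + 3)) p) :
    D.dSphere p v = sphereIncl (D.toSphere p) (D.dToSphere p v) := by
  have h := mfderiv_comp (I := 𝓡 (m + 3)) (I' := 𝓡 (4 * n + 3)) (I'' := 𝓘(ℝ, QSpace n)) p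
    (f := D.toSphere) (g := fun x : S n => (x : QSpace n))
    (contMDiff_coe_sphere.contMDiffAt.mdifferentiableAt (n := ∞) (by simp))
    (D.contMDiff_toSphere.contMDiffAt.mdifferentiableAt (by simp))
  exact congrArg (fun L : EuclideanSpace ℝ (Fin (m + 3)) →L[ℝ] QSpace n => L v) h

theorem mfderiv_incl_dProj (p : P) (v : TangentSpace (𝓡 (m + 3)) p) :
    (mfderiv (𝓡 m) 𝓘(ℝ, Fin n → ℍ[ℝ]) D.incl (D.proj p) (D.dProj p v) : Fin n → ℍ[ℝ]) =
      dHopf (D.toSphere p) (D.dToSphere p v) := by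
  have h1 := mfderiv_comp (I := 𝓡 (m + 3)) (I' := 𝓡 m) (I'' := 𝓘(ℝ, Fin n → ℍ[ℝ])) p
    (f := D.proj) (g := D.incl) (D.isImmersion.contMDiff.contMDiffAt.mdifferentiableAt (by simp))
    (D.contMDiff_proj.contMDiffAt.mdifferentiableAt (by simp))
  have h2 := mfderiv_comp (I := 𝓡 (m + 3)) (I' := 𝓡 (4 * n + 3)) (I'' := 𝓘(ℝ, Fin n → ℍ[ℝ])) p
    (f := D.toSphere) (g := hopf) (contMDiff_hopf.contMDiffAt.mdifferentiableAt (by simp))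
    (D.contMDiff_toSphere.contMDiffAt.mdifferentiableAt (by simp))
  have h3 : D.incl ∘ D.proj = hopf ∘ D.toSphere := funext D.incl_proj
  have h4 := congrArg (fun f : P → HP n =>
    (mfderiv (𝓡 (m + 3)) 𝓘(ℝ, Fin n → ℍ[ℝ]) f p v : Fin n → ℍ[ℝ])) h3
  have h5 := congrArg (fun L : EuclideanSpace ℝ (Fin (m + 3)) →L[ℝ] (Fin n → ℍ[ℝ]) => L v) h1
  have h6 := congrArg (fun L : EuclideanSpace ℝ (Fin (m + 3)) →L[ℝ] (Fin n → ℍ[ℝ]) => L v) h2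
  exact h5.symm.trans (h4.trans h6)

theorem eq_zero_of_dProj_eq_zero_of_dToSphere_eq_zero {p : P} {v : TangentSpace (𝓡 (m + 3)) p}
    (h1 : D.dProj p v = 0) (h2 : D.dToSphere p v = 0) : v = 0 := by
  have hinj := injective_mfderiv_of_isImmersionAt (D.isSmoothEmbedding.isImmersion.isImmersionAt p)
  have h := mfderiv_prodMk (I := 𝓡 (m + 3)) (I' := 𝓡 m) (I'' := 𝓡 (4 * n + 3))
    (D.contMDiff_proj.contMDiffAt.mdifferentiableAt (x := p) (by simp))
    (D.contMDiff_toSphere.contMDiffAt.mdifferentiableAt (x := p) (by simp))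
  rw [h] at hinj
  exact hinj (a₁ := v) (a₂ := 0) (Prod.ext (h1.trans (map_zero (D.dProj p)).symm)
    (h2.trans (map_zero (D.dToSphere p)).symm))

/-- The tangent spaces of `P` are the fibre products of those of `B` and of the sphere. -/
theorem exists_dProj_eq_dToSphere_eq {p : P} {v : TangentSpace (𝓡 m) (D.proj p)}
    {w : TangentSpace (𝓡 (4 * n + 3)) (D.toSphere p)}
    (h : (mfderiv (𝓡 m) 𝓘(ℝ, Fin n → ℍ[ℝ]) D.incl (D.proj p) v : Fin n → ℍ[ℝ]) =
      dHopf (D.toSphere p) w) : ∃ t, D.dProj p t = v ∧ D.dToSphere p t = w := by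
  let f : EuclideanSpace ℝ (Fin (m + 3)) →L[ℝ] EuclideanSpace ℝ (Fin m) := D.dProj p
  let g : EuclideanSpace ℝ (Fin (m + 3)) →L[ℝ] EuclideanSpace ℝ (Fin (4 * n + 3)) := D.dToSphere p
  let a : EuclideanSpace ℝ (Fin m) →L[ℝ] (Fin n → ℍ[ℝ]) :=
    mfderiv (𝓡 m) 𝓘(ℝ, Fin n → ℍ[ℝ]) D.incl (D.proj p)
  let b : EuclideanSpace ℝ (Fin (4 * n + 3)) →L[ℝ] (Fin n → ℍ[ℝ]) := dHopf (D.toSphere p)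
  refine exists_eq_and_eq_of_finrank f.toLinearMap g.toLinearMap a.toLinearMap b.toLinearMap
    (dHopf_surjective _) (D.mfderiv_incl_dProj p)
    (fun t h1 h2 => D.eq_zero_of_dProj_eq_zero_of_dToSphere_eq_zero h1 h2) ?_ h
  rw [Module.finrank_pi_fintype]
  simp [Quaternion.finrank_eq_four]
  ring

theorem dProj_surjective (p : P) : Surjective (D.dProj p) := by
  intro v
  obtain ⟨w, hw⟩ := dHopf_surjective (D.toSphere p)
    (mfderiv (𝓡 m) 𝓘(ℝ, Fin n → ℍ[ℝ]) D.incl (D.proj p) v)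
  obtain ⟨t, ht, -⟩ := D.exists_dProj_eq_dToSphere_eq hw.symm
  exact ⟨t, ht⟩

/-- The fundamental fields exist: the choice in `fundamental` is from a nonempty set. -/
theorem fundamental_spec {q : ℍ[ℝ]} (hq : q.re = 0) (p : P) :
    D.dProj p (D.fundamental q p) = 0 ∧
      D.dSphere p (D.fundamental q p) = rmul (D.toSphere p : QSpace n) q := by
  obtain ⟨w, hw⟩ := exists_sphereIncl_eq (D.toSphere p) (inner_rmul_self hq _)
  obtain ⟨t, ht, ht'⟩ := D.exists_dProj_eq_dToSphere_eq (p := p) (v := 0) (w := w) (by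
    rw [dHopf_eq_zero hw]
    exact ContinuousLinearMap.map_zero _)
  exact Classical.epsilon_spec (p := fun v => D.dProj p v = 0 ∧
    D.dSphere p v = rmul (D.toSphere p : QSpace n) q) ⟨t, ht, by rw [dSphere_eq, ht', hw]⟩

theorem eq_zero_of_dProj_eq_zero_of_dSphere_eq_zero {p : P} {v : TangentSpace (𝓡 (m + 3)) p}
    (h1 : D.dProj p v = 0) (h2 : D.dSphere p v = 0) : v = 0 := by
  refine D.eq_zero_of_dProj_eq_zero_of_dToSphere_eq_zero h1 (sphereIncl_injective _ ?_)
  rw [← dSphere_eq, h2, map_zero]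

/-- Horizontal lifts exist and are linear: the choice in `lift` is from a one-element set. -/
theorem exists_lift_eq (p : P) : ∃ l : TangentSpace (𝓡 m) (D.proj p) →ₗ[ℝ]
    TangentSpace (𝓡 (m + 3)) p, ∀ v, D.lift p v = l v ∧ D.dProj p (l v) = v ∧
      ∀ s, D.dProj p s = 0 → inner ℝ (D.dSphere p s) (D.dSphere p (l v)) = 0 := by
  have : FiniteDimensional ℝ (TangentSpace (𝓡 (m + 3)) p) :=
    inferInstanceAs (FiniteDimensional ℝ (EuclideanSpace ℝ (Fin (m + 3))))
  obtain ⟨l, hl⟩ := exists_orthogonal_lift (D.dProj p).toLinearMap (D.dSphere p).toLinearMap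
    (D.dProj_surjective p) (fun t => D.eq_zero_of_dProj_eq_zero_of_dSphere_eq_zero)
  exact ⟨l, fun v => ⟨(hl v _).1 (Classical.epsilon_spec (p := fun w => D.dProj p w = v ∧
    ∀ s, D.dProj p s = 0 → D.totalMetric p s w = 0) ⟨l v, (hl v _).2 rfl⟩), (hl v _).2 rfl⟩⟩

theorem dProj_lift (p : P) (v : TangentSpace (𝓡 m) (D.proj p)) : D.dProj p (D.lift p v) = v := by
  obtain ⟨l, hl⟩ := D.exists_lift_eq p
  rw [(hl v).1, (hl v).2.1]

theorem lift_smul (p : P) (c : ℝ) (v : TangentSpace (𝓡 m) (D.proj p)) :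
    D.lift p (c • v) = c • D.lift p v := by
  obtain ⟨l, hl⟩ := D.exists_lift_eq p
  rw [(hl _).1, (hl _).1, map_smul]

theorem lift_sum_smul {ι : Type*} (s : Finset ι) (p : P) (c : ι → ℝ)
    (w : ι → TangentSpace (𝓡 m) (D.proj p)) :
    D.lift p (∑ i ∈ s, c i • w i) = ∑ i ∈ s, c i • D.lift p (w i) := by
  obtain ⟨l, hl⟩ := D.exists_lift_eq p
  simp only [(hl _).1, map_sum, map_smul]

theorem inner_rmul_lift {q : ℍ[ℝ]} (hq : q.re = 0) (p : P) (v : TangentSpace (𝓡 m) (D.proj p)) :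
    inner ℝ (rmul (D.toSphere p : QSpace n) q) (D.dSphere p (D.lift p v)) = 0 := by
  obtain ⟨l, hl⟩ := D.exists_lift_eq p
  rw [← (D.fundamental_spec hq p).2, (hl v).1]
  exact (hl v).2.2 _ (D.fundamental_spec hq p).1

variable {u : Fin 3 → ℍ[ℝ]}

theorem etaHat_eq (hu : IsQuaternionTriple u) (a : Fin 3) (p : P) (v : TangentSpace (𝓡 (m + 3)) p) :
    D.etaHat u a p v = inner ℝ (rmul (D.toSphere p : QSpace n) (u a)) (D.dSphere p v) := by
  rw [etaHat, totalMetric, (D.fundamental_spec (hu.re_eq_zero a) p).2]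

theorem etaHat_lift (hu : IsQuaternionTriple u) (a : Fin 3) (p : P)
    (v : TangentSpace (𝓡 m) (D.proj p)) : D.etaHat u a p (D.lift p v) = 0 := by
  rw [D.etaHat_eq hu, D.inner_rmul_lift (hu.re_eq_zero a)]

theorem etaHat_fundamental (hu : IsQuaternionTriple u) (a b : Fin 3) (p : P) :
    D.etaHat u a p (D.fundamental (u b) p) = if a = b then 1 else 0 := by
  have h : ‖(D.toSphere p : QSpace n)‖ = 1 := by simp
  rw [D.etaHat_eq hu, (D.fundamental_spec (hu.re_eq_zero b) p).2, inner_rmul_rmul_self, h,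
    hu.inner_eq]
  simp

theorem etaHat_add (hu : IsQuaternionTriple u) (a : Fin 3) (p : P)
    (v w : TangentSpace (𝓡 (m + 3)) p) :
    D.etaHat u a p (v + w) = D.etaHat u a p v + D.etaHat u a p w := by
  simp only [D.etaHat_eq hu, map_add, inner_add_right]

theorem etaHat_smul (hu : IsQuaternionTriple u) (a : Fin 3) (p : P)
    (c : ℝ) (v : TangentSpace (𝓡 (m + 3)) p) :
    D.etaHat u a p (c • v) = c * D.etaHat u a p v := by
  simp only [D.etaHat_eq hu, map_smul, inner_smul_right]

/-- The coframe of `P` given by the bundle projection and the forms dual to the fundamental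
fields. -/
theorem exists_coframe (hu : IsQuaternionTriple u) (p : P) :
    ∃ θ : TangentSpace (𝓡 (m + 3)) p →ₗ[ℝ] TangentSpace (𝓡 m) (D.proj p) × (Fin 3 → ℝ),
      (∀ v, θ v = (D.dProj p v, fun a => D.etaHat u a p v)) ∧ Bijective θ := by
  let η : TangentSpace (𝓡 (m + 3)) p →ₗ[ℝ] (Fin 3 → ℝ) :=
    { toFun := fun v a => D.etaHat u a p v
      map_add' := fun v w => funext fun a => D.etaHat_add hu a p v w
      map_smul' := fun c v => funext fun a => D.etaHat_smul hu a p c v }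
  let θ := (D.dProj p).toLinearMap.prod η
  have : FiniteDimensional ℝ (TangentSpace (𝓡 (m + 3)) p) :=
    inferInstanceAs (FiniteDimensional ℝ (EuclideanSpace ℝ (Fin (m + 3))))
  have : FiniteDimensional ℝ (TangentSpace (𝓡 m) (D.proj p)) :=
    inferInstanceAs (FiniteDimensional ℝ (EuclideanSpace ℝ (Fin m)))
  have h1 : finrank ℝ (TangentSpace (𝓡 (m + 3)) p) = m + 3 :=
    finrank_euclideanSpace_fin (𝕜 := ℝ) (n := m + 3)
  have h2 : finrank ℝ (TangentSpace (𝓡 m) (D.proj p)) = m :=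
    finrank_euclideanSpace_fin (𝕜 := ℝ) (n := m)
  have hsurj : Surjective θ := by
    rintro ⟨v, c⟩
    refine ⟨D.lift p v + ∑ b, c b • D.fundamental (u b) p, Prod.ext ?_ ?_⟩
    · change D.dProj p _ = v
      rw [map_add, map_sum, D.dProj_lift]
      simp [(D.fundamental_spec (hu.re_eq_zero _) p).1]
    · change η _ = c
      rw [map_add, map_sum]
      funext a
      rw [Pi.add_apply, Finset.sum_apply]
      simp only [map_smul]
      change D.etaHat u a p (D.lift p v) + ∑ b, c b * D.etaHat u a p (D.fundamental (u b) p) = c a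
      simp [D.etaHat_lift hu, D.etaHat_fundamental hu]
  refine ⟨θ, fun v => rfl, ?_, hsurj⟩
  refine (LinearMap.injective_iff_surjective_of_finrank_eq_finrank ?_).2 hsurj
  rw [finrank_prod, h1, h2]
  simp

/-- A tangent vector of `P` is determined by its projection and its vertical components. -/
theorem ext_coframe (hu : IsQuaternionTriple u) {p : P} {v w : TangentSpace (𝓡 (m + 3)) p}
    (h : D.dProj p v = D.dProj p w) (h' : ∀ a, D.etaHat u a p v = D.etaHat u a p w) : v = w := by
  obtain ⟨θ, hθ, hb⟩ := D.exists_coframe hu p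
  apply hb.1
  rw [hθ, hθ, h]
  simp only [h']

/-- The decomposition of a tangent vector into its vertical and horizontal parts. -/
theorem eq_sum_add_lift (hu : IsQuaternionTriple u) (p : P) (v : TangentSpace (𝓡 (m + 3)) p) :
    v = ∑ a, D.etaHat u a p v • D.fundamental (u a) p + D.lift p (D.dProj p v) := by
  refine D.ext_coframe hu ?_ fun a => ?_
  · rw [map_add, map_sum, D.dProj_lift]
    simp [(D.fundamental_spec (hu.re_eq_zero _) p).1]
  · rw [D.etaHat_add hu, D.etaHat_lift hu, Fin.sum_univ_three, D.etaHat_add hu, D.etaHat_add hu]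
    simp only [D.etaHat_smul hu, D.etaHat_fundamental hu]
    fin_cases a <;> simp

end InducedHopfBundle

/-! ### The derivative of a scalar product -/

section General

variable {d : ℕ} {M : Type*} [TopologicalSpace M] [ChartedSpace (EuclideanSpace ℝ (Fin d)) M]
  {V : Type*} [NormedAddCommGroup V] [InnerProductSpace ℝ V]

theorem mvfderiv_inner_apply {F G : M → V} {x : M} (hF : MDifferentiableAt (𝓡 d) 𝓘(ℝ, V) F x)
    (hG : MDifferentiableAt (𝓡 d) 𝓘(ℝ, V) G x) (v : TangentSpace (𝓡 d) x) :
    mvfderiv (𝓡 d) (fun y => inner ℝ (F y) (G y)) x v =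
      inner ℝ (F x) (mvfderiv (𝓡 d) G x v) + inner ℝ (mvfderiv (𝓡 d) F x v) (G x) := by
  have hF' := hF.hasMFDerivAt
  have hG' := hG.hasMFDerivAt
  have h : HasMFDerivAt (𝓡 d) 𝓘(ℝ, ℝ) (fun y => inner ℝ (F y) (G y)) x
      ((innerSL ℝ (F x)).comp (mvfderiv (𝓡 d) G x) +
        (innerSL ℝ (G x)).comp (mvfderiv (𝓡 d) F x)) := by
    refine ⟨hF'.1.inner hG'.1, ?_⟩
    have := (hF'.2.inner ℝ hG'.2)
    simp only [writtenInExtChartAt, extChartAt_model_space_eq_id, Function.comp_apply,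
      extChartAt_to_inv] at this
    refine this.congr_fderiv ?_
    ext w
    refine (fderivInnerCLM_apply ℝ _ _).trans ?_
    change _ = inner ℝ (F x) (mvfderiv (𝓡 d) G x w) + inner ℝ (G x) (mvfderiv (𝓡 d) F x w)
    rw [real_inner_comm _ (G x)]
    rfl
  have h' := congrArg (fun L : EuclideanSpace ℝ (Fin d) →L[ℝ] ℝ => L v) h.mfderiv
  refine h'.trans ?_
  change inner ℝ (F x) (mvfderiv (𝓡 d) G x v) + inner ℝ (G x) (mvfderiv (𝓡 d) F x v) = _
  rw [real_inner_comm (G x)]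

end General

/-! ### Brackets of fundamental fields and horizontal lifts -/

namespace InducedHopfBundle

variable {n m : ℕ} {B P : Type*}
  [TopologicalSpace B] [ChartedSpace (EuclideanSpace ℝ (Fin m)) B] [IsManifold (𝓡 m) ∞ B]
  [TopologicalSpace P] [ChartedSpace (EuclideanSpace ℝ (Fin (m + 3))) P]
  [IsManifold (𝓡 (m + 3)) ∞ P]
  (D : InducedHopfBundle n m B P) {u : Fin 3 → ℍ[ℝ]}

omit [IsManifold (𝓡 m) ∞ B] [IsManifold (𝓡 (m + 3)) ∞ P] in
/-- The metric of `B` is pointwise induced by an injective linear map into a Euclidean space. -/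
theorem exists_baseMetric_eq_inner (b : B) :
    ∃ l : TangentSpace (𝓡 m) b →ₗ[ℝ] QSpace n, Injective l ∧
      ∀ v w, D.baseMetric b v w = inner ℝ (l v) (l w) := by
  obtain ⟨l, hl, h⟩ := exists_hpMetric_eq_inner (D.incl b)
  exact ⟨l ∘ₗ (mfderiv (𝓡 m) 𝓘(ℝ, Fin n → ℍ[ℝ]) D.incl b).toLinearMap,
    hl.comp (injective_mfderiv_of_isImmersionAt (D.isImmersion.isImmersionAt b)),
    fun v w => h _ _⟩

omit [IsManifold (𝓡 m) ∞ B] in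
theorem contMDiffAt_etaHat (hu : IsQuaternionTriple u) (a : Fin 3)
    {A : ∀ p : P, TangentSpace (𝓡 (m + 3)) p} {p : P} (hA : SmoothFieldAt A p) :
    ContMDiffAt (𝓡 (m + 3)) 𝓘(ℝ, ℝ) ∞ (fun q => D.etaHat u a q (A q)) p := by
  have h : (fun q => D.etaHat u a q (A q)) = fun q =>
      innerSL ℝ (rmulL n (u a) (D.toSphere q : QSpace n)) (D.dSphere q (A q)) := by
    funext q
    exact D.etaHat_eq hu a q _
  rw [h]
  have h1 : ContMDiffAt (𝓡 (m + 3)) 𝓘(ℝ, QSpace n) ∞ (fun q => D.dSphere q (A q)) p :=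
    contMDiffAt_mvfderiv_apply D.contMDiff_coe_toSphere.contMDiffAt hA
  have h2 : ContMDiffAt (𝓡 (m + 3)) 𝓘(ℝ, QSpace n →L[ℝ] ℝ) ∞
      (fun q => innerSL ℝ (rmulL n (u a) (D.toSphere q : QSpace n))) p :=
    ((innerSL ℝ).contMDiff.comp ((rmulL n (u a)).contMDiff.comp
      D.contMDiff_coe_toSphere)).contMDiffAt
  exact h2.clm_apply h1

omit [IsManifold (𝓡 (m + 3)) ∞ P] in
theorem mvfderiv_chart_comp_proj {p q : P}
    (hq : D.proj q ∈ (chartAt (EuclideanSpace ℝ (Fin m)) (D.proj p)).source)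
    (v : TangentSpace (𝓡 (m + 3)) q) :
    mvfderiv (𝓡 (m + 3)) (extChartAt (𝓡 m) (D.proj p) ∘ D.proj) q v =
      mvfderiv (𝓡 m) (extChartAt (𝓡 m) (D.proj p)) (D.proj q) (D.dProj q v) := by
  have h := mfderiv_comp q (mdifferentiableAt_extChartAt (I := 𝓡 m) hq)
    (D.contMDiff_proj.contMDiffAt.mdifferentiableAt (by simp))
  exact congrArg (fun L : EuclideanSpace ℝ (Fin (m + 3)) →L[ℝ] EuclideanSpace ℝ (Fin m) => L v) h

/-- A vector field on `P` is smooth when its projection to `B` and its values under the forms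
dual to the fundamental fields are smooth. -/
theorem smoothFieldAt_of_proj_of_etaHat (hu : IsQuaternionTriple u)
    {A : ∀ p : P, TangentSpace (𝓡 (m + 3)) p} {p : P}
    (h1 : ContMDiffAt (𝓡 (m + 3)) 𝓘(ℝ, EuclideanSpace ℝ (Fin m)) ∞
      (fun q => mvfderiv (𝓡 (m + 3)) (extChartAt (𝓡 m) (D.proj p) ∘ D.proj) q (A q)) p)
    (h2 : ∀ a, ContMDiffAt (𝓡 (m + 3)) 𝓘(ℝ, ℝ) ∞ (fun q => D.etaHat u a q (A q)) p) :
    SmoothFieldAt A p := by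
  have hφ : ContMDiffAt (𝓡 (m + 3)) 𝓘(ℝ, EuclideanSpace ℝ (Fin m)) ∞
      (extChartAt (𝓡 m) (D.proj p) ∘ D.proj) p :=
    contMDiffAt_extChartAt.comp p D.contMDiff_proj.contMDiffAt
  let η (q : P) : TangentSpace (𝓡 (m + 3)) q →ₗ[ℝ] (Fin 3 → ℝ) :=
    { toFun := fun v a => D.etaHat u a q v
      map_add' := fun v w => funext fun a => D.etaHat_add hu a q v w
      map_smul' := fun c v => funext fun a => D.etaHat_smul hu a q c v }
  let θ (q : P) : TangentSpace (𝓡 (m + 3)) q →ₗ[ℝ] EuclideanSpace ℝ (Fin m) × (Fin 3 → ℝ) :=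
    (mvfderiv (𝓡 (m + 3)) (extChartAt (𝓡 m) (D.proj p) ∘ D.proj) q).toLinearMap.prod (η q)
  have hbij : ∀ q, D.proj q ∈ (chartAt (EuclideanSpace ℝ (Fin m)) (D.proj p)).source →
      Bijective (θ q) := by
    intro q hq
    obtain ⟨θ', hθ', hb⟩ := D.exists_coframe hu q
    have hi : Bijective (mvfderiv (𝓡 m) (extChartAt (𝓡 m) (D.proj p)) (D.proj q)) :=
      (isInvertible_mfderiv_extChartAt (I := 𝓡 m) (by simpa using hq)).bijective
    have heq : ⇑(θ q) =
        Prod.map (mvfderiv (𝓡 m) (extChartAt (𝓡 m) (D.proj p)) (D.proj q)) id ∘ θ' := by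
      funext v
      rw [comp_apply, hθ']
      exact Prod.ext (D.mvfderiv_chart_comp_proj hq v) rfl
    rw [heq]
    exact (hi.prodMap bijective_id).comp hb
  have hnear : ∀ᶠ q in 𝓝 p, D.proj q ∈ (chartAt (EuclideanSpace ℝ (Fin m)) (D.proj p)).source :=
    D.contMDiff_proj.continuous.continuousAt (chart_source_mem_nhds _ _)
  refine smoothFieldAt_of_coframe (θ := θ) (fun A hA => ?_) ?_ (hbij p (mem_chart_source _ _)).2 ?_
  · exact (contMDiffAt_mvfderiv_apply hφ hA).prodMk_space
      (contMDiffAt_pi_space.2 fun a => D.contMDiffAt_etaHat hu a hA)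
  · filter_upwards [hnear] with q hq
    exact (hbij q hq).1
  · exact h1.prodMk_space (contMDiffAt_pi_space.2 h2)

theorem smoothField_liftField (hu : IsQuaternionTriple u) {X : ∀ b : B, TangentSpace (𝓡 m) b}
    (hX : SmoothField X) : SmoothField (D.liftField X) := by
  intro p
  refine D.smoothFieldAt_of_proj_of_etaHat hu ?_ fun a => ?_
  · have h := (contMDiffAt_mvfderiv_apply (contMDiffAt_extChartAt (x := D.proj p)) (hX _)).comp p
      D.contMDiff_proj.contMDiffAt
    refine h.congr_of_eventuallyEq ?_
    filter_upwards [D.contMDiff_proj.continuous.continuousAt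
      (chart_source_mem_nhds (EuclideanSpace ℝ (Fin m)) (D.proj p))] with q hq
    rw [D.mvfderiv_chart_comp_proj hq, liftField, D.dProj_lift]
    rfl
  · simp only [liftField, D.etaHat_lift hu]
    exact contMDiffAt_const

theorem smoothField_fundamental (hu : IsQuaternionTriple u) (b : Fin 3) :
    SmoothField (D.fundamental (u b)) := by
  intro p
  refine D.smoothFieldAt_of_proj_of_etaHat hu ?_ fun a => ?_
  · refine (contMDiffAt_const (c := 0)).congr_of_eventuallyEq ?_
    filter_upwards [D.contMDiff_proj.continuous.continuousAt
      (chart_source_mem_nhds (EuclideanSpace ℝ (Fin m)) (D.proj p))] with q hq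
    rw [D.mvfderiv_chart_comp_proj hq, (D.fundamental_spec (hu.re_eq_zero b) q).1, map_zero]
  · simp only [D.etaHat_fundamental hu]
    exact contMDiffAt_const

theorem dProj_mlieBracket_liftField (hu : IsQuaternionTriple u)
    {X Y : ∀ b : B, TangentSpace (𝓡 m) b} (hX : SmoothField X) (hY : SmoothField Y) (p : P) :
    D.dProj p (VectorField.mlieBracket (𝓡 (m + 3)) (D.liftField X) (D.liftField Y) p) =
      VectorField.mlieBracket (𝓡 m) X Y (D.proj p) :=
  mfderiv_mlieBracket_of_related D.contMDiff_proj (D.smoothField_liftField hu hX p)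
    (D.smoothField_liftField hu hY p) (hX _) (hY _) (fun q => D.dProj_lift q _)
    (fun q => D.dProj_lift q _)

/-- A bracket with a fundamental field is vertical, if the other field is projectable. -/
theorem dProj_mlieBracket_fundamental (hu : IsQuaternionTriple u) (a : Fin 3)
    {A : ∀ p : P, TangentSpace (𝓡 (m + 3)) p} (hA : SmoothField A)
    {X : ∀ b : B, TangentSpace (𝓡 m) b} (hX : SmoothField X)
    (hAX : ∀ q, D.dProj q (A q) = X (D.proj q)) (p : P) :
    D.dProj p (VectorField.mlieBracket (𝓡 (m + 3)) (D.fundamental (u a)) A p) = 0 := by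
  have h := mfderiv_mlieBracket_of_related D.contMDiff_proj (D.smoothField_fundamental hu a p)
    (hA p) (X := 0) (smoothFieldAt_zero _) (hX _)
    (fun q => (D.fundamental_spec (hu.re_eq_zero a) q).1) hAX
  rw [VectorField.mlieBracket_zero_left] at h
  exact h

omit [IsManifold (𝓡 m) ∞ B] in
theorem dSphere_mlieBracket {A C : ∀ p : P, TangentSpace (𝓡 (m + 3)) p} {p : P}
    (hA : SmoothFieldAt A p) (hC : SmoothFieldAt C p) :
    D.dSphere p (VectorField.mlieBracket (𝓡 (m + 3)) A C p) =
      mvfderiv (𝓡 (m + 3)) (fun q => D.dSphere q (C q)) p (A p) -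
        mvfderiv (𝓡 (m + 3)) (fun q => D.dSphere q (A q)) p (C p) :=
  mvfderiv_mlieBracket D.contMDiff_coe_toSphere.contMDiffAt hA hC

omit [IsManifold (𝓡 m) ∞ B] [IsManifold (𝓡 (m + 3)) ∞ P] in
theorem mvfderiv_rmul_toSphere (q : ℍ[ℝ]) (p : P) (v : TangentSpace (𝓡 (m + 3)) p) :
    mvfderiv (𝓡 (m + 3)) (fun r => rmul (D.toSphere r : QSpace n) q) p v =
      rmul (D.dSphere p v) q := by
  have h := mfderiv_comp p (g := rmulL n q) (f := fun r : P => (D.toSphere r : QSpace n))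
    (rmulL n q).differentiableAt.mdifferentiableAt
    (D.contMDiff_coe_toSphere.contMDiffAt.mdifferentiableAt (by simp))
  rw [mfderiv_eq_fderiv, (rmulL n q).fderiv] at h
  exact congrArg (fun L : EuclideanSpace ℝ (Fin (m + 3)) →L[ℝ] QSpace n => L v) h

omit [IsManifold (𝓡 m) ∞ B] [IsManifold (𝓡 (m + 3)) ∞ P] in
theorem dSphere_fundamental (hu : IsQuaternionTriple u) (b : Fin 3) :
    (fun q => D.dSphere q (D.fundamental (u b) q)) =
      fun q => rmul (D.toSphere q : QSpace n) (u b) :=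
  funext fun q => (D.fundamental_spec (hu.re_eq_zero b) q).2

theorem dSphere_mlieBracket_fundamental (hu : IsQuaternionTriple u) (a b : Fin 3) (p : P) :
    D.dSphere p (VectorField.mlieBracket (𝓡 (m + 3)) (D.fundamental (u a))
      (D.fundamental (u b)) p) = rmul (D.toSphere p : QSpace n) (u a * u b - u b * u a) := by
  rw [D.dSphere_mlieBracket (D.smoothField_fundamental hu a p) (D.smoothField_fundamental hu b p),
    D.dSphere_fundamental hu, D.dSphere_fundamental hu, D.mvfderiv_rmul_toSphere,
    D.mvfderiv_rmul_toSphere, (D.fundamental_spec (hu.re_eq_zero a) p).2,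
    (D.fundamental_spec (hu.re_eq_zero b) p).2, rmul_rmul, rmul_rmul, sub_eq_add_neg,
    sub_eq_add_neg, rmul_add, rmul_neg]

/-- The bracket relations of the unit quaternions. -/
theorem mlieBracket_fundamental (hu : IsQuaternionTriple u) {a b c : Fin 3} {r : ℝ}
    (h : u a * u b - u b * u a = r • u c) (p : P) :
    VectorField.mlieBracket (𝓡 (m + 3)) (D.fundamental (u a)) (D.fundamental (u b)) p =
      r • D.fundamental (u c) p := by
  rw [← sub_eq_zero]
  refine D.eq_zero_of_dProj_eq_zero_of_dSphere_eq_zero ?_ ?_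
  · rw [map_sub, map_smul, (D.fundamental_spec (hu.re_eq_zero c) p).1, smul_zero, sub_zero]
    exact D.dProj_mlieBracket_fundamental hu a (D.smoothField_fundamental hu b)
      (X := fun _ => 0) smoothFieldAt_zero (fun q => (D.fundamental_spec (hu.re_eq_zero b) q).1) p
  · rw [map_sub, map_smul, D.dSphere_mlieBracket_fundamental hu, h,
      (D.fundamental_spec (hu.re_eq_zero c) p).2, rmul_smul, sub_self]

/-- Horizontal lifts are invariant under the structure group. -/
theorem mlieBracket_fundamental_liftField (hu : IsQuaternionTriple u) (a : Fin 3)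
    {X : ∀ b : B, TangentSpace (𝓡 m) b} (hX : SmoothField X) (p : P) :
    VectorField.mlieBracket (𝓡 (m + 3)) (D.fundamental (u a)) (D.liftField X) p = 0 := by
  refine D.ext_coframe hu ?_ fun c => ?_
  · rw [map_zero]
    exact D.dProj_mlieBracket_fundamental hu a (D.smoothField_liftField hu hX) hX
      (fun q => D.dProj_lift q _) p
  have hL := D.smoothField_liftField hu hX
  have hdL : ContMDiffAt (𝓡 (m + 3)) 𝓘(ℝ, QSpace n) ∞ (fun q => D.dSphere q (D.liftField X q)) p :=
    contMDiffAt_mvfderiv_apply D.contMDiff_coe_toSphere.contMDiffAt (hL p)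
  have hR : ContMDiff (𝓡 (m + 3)) 𝓘(ℝ, QSpace n) ∞
      (fun q => rmul (D.toSphere q : QSpace n) (u c)) :=
    (rmulL n (u c)).contMDiff.comp D.contMDiff_coe_toSphere
  -- differentiate the orthogonality of horizontal and vertical vectors
  have horth : (fun q => inner ℝ (rmul (D.toSphere q : QSpace n) (u c))
      (D.dSphere q (D.liftField X q))) = fun _ => 0 :=
    funext fun q => D.inner_rmul_lift (hu.re_eq_zero c) q _
  have hder := mvfderiv_inner_apply (hR.contMDiffAt.mdifferentiableAt (by simp))
    (hdL.mdifferentiableAt (by simp)) (D.fundamental (u a) p)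
  rw [horth, mvfderiv_const, D.mvfderiv_rmul_toSphere,
    (D.fundamental_spec (hu.re_eq_zero a) p).2] at hder
  have hre : (u c * u a - u a * u c).re = 0 := by
    simp only [Quaternion.re_sub, Quaternion.re_mul]
    ring
  have hcomm := D.inner_rmul_lift hre p (X (D.proj p))
  rw [sub_eq_add_neg, rmul_add, rmul_neg, ← sub_eq_add_neg, inner_sub_left] at hcomm
  have hz : D.etaHat u c p (0 : TangentSpace (𝓡 (m + 3)) p) = 0 := by
    rw [D.etaHat_eq hu, map_zero, inner_zero_right]
  rw [hz, D.etaHat_eq hu, D.dSphere_mlieBracket (D.smoothField_fundamental hu a p) (hL p),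
    D.dSphere_fundamental hu, D.mvfderiv_rmul_toSphere, inner_sub_right]
  have hskew := inner_rmul_left (hu.re_eq_zero a) (rmul (D.toSphere p : QSpace n) (u c))
    (D.dSphere p (D.liftField X p))
  rw [rmul_rmul] at hder hskew
  simp only [zero_apply] at hder
  simp only [liftField] at *
  linarith

omit [IsManifold (𝓡 m) ∞ B] [IsManifold (𝓡 (m + 3)) ∞ P] in
theorem horizontal_liftField (hu : IsQuaternionTriple u) (X : ∀ b : B, TangentSpace (𝓡 m) b) :
    D.horizontal u (D.liftField X) = D.liftField X := by
  funext p
  simp [horizontal, liftField, D.etaHat_lift hu]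

omit [IsManifold (𝓡 m) ∞ B] [IsManifold (𝓡 (m + 3)) ∞ P] in
/-- The curvature on horizontal lifts is minus the vertical part of their bracket. -/
theorem curvature_liftField (hu : IsQuaternionTriple u) (X Y : ∀ b : B, TangentSpace (𝓡 m) b)
    (p : P) : D.curvature u (D.liftField X) (D.liftField Y) p =
      -∑ a, D.etaHat u a p (VectorField.mlieBracket (𝓡 (m + 3)) (D.liftField X) (D.liftField Y) p)
        • u a := by
  have h : ∀ X : (∀ b : B, TangentSpace (𝓡 m) b),
      (fun q => D.connForm u q (D.liftField X q)) = fun _ => 0 := by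
    intro X
    funext q
    simp [connForm, liftField, D.etaHat_lift hu]
  rw [curvature, D.horizontal_liftField hu, D.horizontal_liftField hu, dConnForm, h, h,
    mvfderiv_const]
  simp [connForm]

theorem inner_sum_smul (hu : IsQuaternionTriple u) (c : Fin 3 → ℝ) (a : Fin 3) :
    inner ℝ (u a) (∑ b, c b • u b) = c a := by
  simp [inner_sum, inner_smul_right, hu.inner_eq]

end InducedHopfBundle

/-! ### Sasakian structures -/

section Sasakian

variable {d : ℕ} {M : Type*} [TopologicalSpace M] [ChartedSpace (EuclideanSpace ℝ (Fin d)) M]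

/-- A scalar product on each tangent space; smoothness in the base point is not part of it. -/
structure IsScalarProduct (g : ∀ x : M, TangentSpace (𝓡 d) x → TangentSpace (𝓡 d) x → ℝ) :
    Prop where
  symm : ∀ (x : M) (v w : TangentSpace (𝓡 d) x), g x v w = g x w v
  add_left : ∀ (x : M) (v v' w : TangentSpace (𝓡 d) x), g x (v + v') w = g x v w + g x v' w
  smul_left : ∀ (x : M) (c : ℝ) (v w : TangentSpace (𝓡 d) x), g x (c • v) w = c * g x v w
  eq_zero : ∀ (x : M) (v : TangentSpace (𝓡 d) x), g x v v = 0 → v = 0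

variable {g : ∀ x : M, TangentSpace (𝓡 d) x → TangentSpace (𝓡 d) x → ℝ}

namespace IsScalarProduct

variable (hg : IsScalarProduct g) (x : M) (v w w' : TangentSpace (𝓡 d) x)
include hg

theorem add_right : g x v (w + w') = g x v w + g x v w' := by
  rw [hg.symm, hg.add_left, hg.symm x w, hg.symm x w']

theorem smul_right (c : ℝ) : g x v (c • w) = c * g x v w := by
  rw [hg.symm, hg.smul_left, hg.symm x w]

theorem neg_right : g x v (-w) = -g x v w := by
  simpa using hg.smul_right x v w (-1)

theorem sub_right : g x v (w - w') = g x v w - g x v w' := by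
  rw [sub_eq_add_neg, hg.add_right, hg.neg_right, sub_eq_add_neg]

theorem zero_left : g x 0 v = 0 := by
  simpa using hg.smul_left x 0 0 v

theorem zero_right : g x v 0 = 0 := by
  rw [hg.symm, hg.zero_left]

end IsScalarProduct

variable [IsManifold (𝓡 d) ∞ M]

/-- A function is smooth where its product with a nonvanishing smooth field is smooth. -/
theorem contMDiffAt_of_smul {a : M → ℝ} {W : ∀ x : M, TangentSpace (𝓡 d) x} {x : M}
    (hW : SmoothFieldAt W x) (h0 : W x ≠ 0) (h : SmoothFieldAt (fun y => a y • W y) x) :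
    ContMDiffAt (𝓡 d) 𝓘(ℝ, ℝ) ∞ a x := by
  let t := trivializationAt (EuclideanSpace ℝ (Fin d)) (fun y : M => TangentSpace (𝓡 d) y) x
  have hx : x ∈ t.baseSet := FiberBundle.mem_baseSet_trivializationAt' x
  have hsec : ∀ A : (∀ x : M, TangentSpace (𝓡 d) x), SmoothFieldAt A x →
      ContMDiffAt (𝓡 d) 𝓘(ℝ, ℝ) ∞ (fun y => innerSL ℝ (t.continuousLinearMapAt ℝ x (W x))
        (t.continuousLinearMapAt ℝ y (A y))) x := by
    intro A hA
    have hc : ContMDiffAt (𝓡 d) 𝓘(ℝ, EuclideanSpace ℝ (Fin d)) ∞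
        (fun y => t.continuousLinearMapAt ℝ y (A y)) x := by
      refine ((t.contMDiffAt_section_iff hx).1 hA).congr_of_eventuallyEq ?_
      filter_upwards [t.open_baseSet.mem_nhds hx] with y hy
      exact t.continuousLinearMapAt_apply_of_mem ℝ hy (A y)
    exact (innerSL ℝ (t.continuousLinearMapAt ℝ x (W x))).contMDiff.contMDiffAt.comp x hc
  have hne : t.continuousLinearMapAt ℝ x (W x) ≠ 0 := by
    intro hz
    apply h0
    rw [← t.symmL_continuousLinearMapAt (R := ℝ) hx (W x), hz, map_zero]
  have hne' : innerSL ℝ (t.continuousLinearMapAt ℝ x (W x))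
      (t.continuousLinearMapAt ℝ x (W x)) ≠ 0 := by
    simpa using hne
  refine ((hsec _ h).mul ((hsec W hW).inv₀ hne')).congr_of_eventuallyEq ?_
  filter_upwards [(hsec W hW).continuousAt.eventually_ne hne'] with y hy
  simp only [Pi.mul_apply, map_smul, smul_eq_mul]
  field_simp

namespace IsSasakian

variable [T2Space M] [SecondCountableTopology M] {nabla : Connection d M}
  {xi : ∀ x : M, TangentSpace (𝓡 d) x} (hS : IsSasakian g nabla xi) (hg : IsScalarProduct g)
  (x : M) (v w : TangentSpace (𝓡 d) x)
include hS

omit [T2Space M] [SecondCountableTopology M] in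
theorem smooth_phi {X : ∀ x : M, TangentSpace (𝓡 d) x} (hX : SmoothField X) :
    SmoothField fun y => nabla xi y (X y) :=
  hS.leviCivita.smooth X xi hX hS.smooth

include hg

theorem xi_phi : g x (xi x) (nabla xi x v) = 0 := by
  obtain ⟨X, hX, rfl⟩ := exists_smoothField_eq x v
  have h := hS.leviCivita.metric X xi xi hX hS.smooth hS.smooth x
  have h1 : (fun y => g y (xi y) (xi y)) = fun _ => 1 := funext hS.unit
  rw [h1, mvfderiv_const, hg.symm x (nabla xi x (X x))] at h
  simp only [zero_apply] at h
  linarith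

theorem phi_xi : nabla xi x (xi x) = 0 := by
  apply hg.eq_zero
  have h := hS.killing x (xi x) (nabla xi x (xi x))
  rwa [hS.xi_phi hg, add_zero] at h

/-- `φ² = -1 + η ⊗ ξ`, from the formula for `∇φ` applied to `φξ = 0`. -/
theorem phi_phi : nabla xi x (nabla xi x v) = g x (xi x) v • xi x - v := by
  obtain ⟨X, hX, rfl⟩ := exists_smoothField_eq x v
  have h := hS.deriv_phi X xi hX hS.smooth x
  have h1 : (fun y => nabla xi y (xi y)) = 0 := funext (hS.phi_xi hg)
  rw [h1, CovariantDerivative.zero, hS.unit, hg.symm x (X x)] at h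
  simp only [Pi.zero_apply, zero_apply, zero_sub, one_smul] at h
  rw [← neg_inj, h, neg_sub]

theorem metric_phi_phi :
    g x (nabla xi x v) (nabla xi x w) = g x v w - g x (xi x) v * g x (xi x) w := by
  have h := hS.killing x v (nabla xi x w)
  rw [hS.phi_phi hg, hg.sub_right, hg.smul_right, hg.symm x v (xi x)] at h
  linarith

/-- The contact form is smooth on smooth fields. The metric is not assumed to be smooth:
`η(X)` is the coefficient of `ξ` in the smooth field `X + φ²X = η(X) ξ`. -/
theorem contMDiff_eta {X : ∀ x : M, TangentSpace (𝓡 d) x} (hX : SmoothField X) :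
    ContMDiff (𝓡 d) 𝓘(ℝ, ℝ) ∞ fun y => g y (xi y) (X y) := by
  intro y
  refine contMDiffAt_of_smul (hS.smooth y) (fun h => ?_)
    (((hS.smooth_phi (hS.smooth_phi hX) y).add (hX y)).congr (.of_forall fun z => ?_))
  · have := hS.unit y
    rw [h, hg.zero_left] at this
    exact zero_ne_one this
  · rw [hS.phi_phi hg, sub_add_cancel]

/-- The smooth extension of a vector orthogonal to `ξ` can be chosen orthogonal to `ξ`: apply
`-φ²` to any extension. -/
theorem exists_smoothField_perp : ∃ X : ∀ x : M, TangentSpace (𝓡 d) x, SmoothField X ∧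
    (∀ y, g y (xi y) (X y) = 0) ∧ X x = v - g x (xi x) v • xi x := by
  obtain ⟨X, hX, rfl⟩ := exists_smoothField_eq x v
  refine ⟨fun y => -nabla xi y (nabla xi y (X y)),
    fun y => (hS.smooth_phi (hS.smooth_phi hX) y).neg, fun y => ?_, ?_⟩
  · rw [hg.neg_right, hS.xi_phi hg, neg_zero]
  · beta_reduce
    rw [hS.phi_phi hg, neg_sub]

variable {X Y : ∀ x : M, TangentSpace (𝓡 d) x} (hX : SmoothField X) (hY : SmoothField Y)
include hX hY

omit [T2Space M] [SecondCountableTopology M] hg in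
theorem eta_nabla (hYxi : ∀ y, g y (xi y) (Y y) = 0) :
    g x (xi x) (nabla Y x (X x)) = -g x (nabla xi x (X x)) (Y x) := by
  have h := hS.leviCivita.metric X xi Y hX hS.smooth hY x
  rw [funext hYxi, mvfderiv_const] at h
  simp only [zero_apply] at h
  linarith

omit [T2Space M] [SecondCountableTopology M] in
/-- On the contact distribution, `dη = 2 g(φ·, ·)`. -/
theorem eta_mlieBracket (hXxi : ∀ y, g y (xi y) (X y) = 0) (hYxi : ∀ y, g y (xi y) (Y y) = 0) :
    g x (xi x) (VectorField.mlieBracket (𝓡 d) X Y x) = -2 * g x (nabla xi x (X x)) (Y x) := by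
  have h := hS.killing x (X x) (Y x)
  rw [← hS.leviCivita.torsion_free X Y hX hY, hg.sub_right,
    hS.eta_nabla x hX hY hYxi, hS.eta_nabla x hY hX hXxi, hg.symm x _ (X x)]
  linarith

omit hY in
/-- The flow of `ξ` preserves the contact distribution. -/
theorem eta_mlieBracket_xi (hXxi : ∀ y, g y (xi y) (X y) = 0) :
    g x (xi x) (VectorField.mlieBracket (𝓡 d) xi X x) = 0 := by
  rw [← hS.leviCivita.torsion_free xi X hS.smooth hX, hg.sub_right, hS.xi_phi hg,
    hS.eta_nabla x hS.smooth hX hXxi, hS.phi_xi hg, hg.zero_left]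
  simp

/-- On the contact distribution, `dη` is of type `(1, 1)` with respect to `φ`. -/
theorem eta_mlieBracket_phi (hXxi : ∀ y, g y (xi y) (X y) = 0)
    (hYxi : ∀ y, g y (xi y) (Y y) = 0) :
    g x (xi x) (VectorField.mlieBracket (𝓡 d) (fun y => nabla xi y (X y)) Y x) +
      g x (xi x) (VectorField.mlieBracket (𝓡 d) X (fun y => nabla xi y (Y y)) x) = 0 := by
  rw [hS.eta_mlieBracket hg x (hS.smooth_phi hX) hY (fun y => hS.xi_phi hg y _) hYxi,
    hS.eta_mlieBracket hg x hX (hS.smooth_phi hY) hXxi (fun y => hS.xi_phi hg y _),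
    hS.phi_phi hg, hS.metric_phi_phi hg, hXxi, zero_smul, zero_sub, hg.symm x (-X x),
    hg.neg_right, hg.symm x (Y x)]
  ring

omit [T2Space M] [SecondCountableTopology M] hg hY in
/-- The flow of `ξ` preserves `φ`. -/
theorem mlieBracket_xi_phi :
    VectorField.mlieBracket (𝓡 d) xi (fun y => nabla xi y (X y)) x =
      nabla xi x (VectorField.mlieBracket (𝓡 d) xi X x) := by
  have h := hS.deriv_phi xi X hS.smooth hX x
  rw [sub_self, sub_eq_zero] at h
  rw [← hS.leviCivita.torsion_free _ _ hS.smooth (hS.smooth_phi hX),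
    ← hS.leviCivita.torsion_free _ _ hS.smooth hX, map_sub, h]

/-- The Nijenhuis expression of `φ` vanishes on the contact distribution: a Sasakian structure is
a normal contact structure. -/
theorem nijenhuis_phi (hXxi : ∀ y, g y (xi y) (X y) = 0) (hYxi : ∀ y, g y (xi y) (Y y) = 0) :
    VectorField.mlieBracket (𝓡 d) X Y x
      + nabla xi x (VectorField.mlieBracket (𝓡 d) (fun y => nabla xi y (X y)) Y x)
      + nabla xi x (VectorField.mlieBracket (𝓡 d) X (fun y => nabla xi y (Y y)) x)
      - VectorField.mlieBracket (𝓡 d) (fun y => nabla xi y (X y)) (fun y => nabla xi y (Y y)) x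
      = 0 := by
  have hφX := hS.smooth_phi hX
  have hφY := hS.smooth_phi hY
  have hT := hS.leviCivita.torsion_free
  have e1 := hS.deriv_phi _ Y hφX hY x
  have e2 := hS.deriv_phi _ X hφY hX x
  have e3 := hS.deriv_phi Y X hY hX x
  have e4 := hS.deriv_phi X Y hX hY x
  have hk := hS.killing x (X x) (Y x)
  rw [hXxi, zero_smul, zero_sub, sub_eq_iff_eq_add] at e2 e3
  rw [hYxi, zero_smul, zero_sub, sub_eq_iff_eq_add] at e1 e4
  rw [← hT _ _ hX hY, ← hT _ _ hφX hY, ← hT _ _ hX hφY, ← hT _ _ hφX hφY, e1, e2, e3, e4]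
  simp only [map_sub, map_add, map_neg, map_smul, hS.phi_phi hg, hS.phi_xi hg,
    hS.eta_nabla x hX hY hYxi, hS.eta_nabla x hY hX hXxi]
  rw [hg.symm x (nabla xi x (Y x)) (X x), eq_neg_of_add_eq_zero_right hk]
  module

end IsSasakian

end Sasakian

/-! ### Complex frames -/

section General

variable {d : ℕ} {M : Type*} [TopologicalSpace M] [ChartedSpace (EuclideanSpace ℝ (Fin d)) M]
  [IsManifold (𝓡 d) ∞ M]

/-- A field of endomorphisms is smooth if it maps the members of a smooth spanning family to
smooth fields. -/
theorem smoothFieldAt_of_frame {J : ∀ x : M, TangentSpace (𝓡 d) x → TangentSpace (𝓡 d) x}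
    (hadd : ∀ x v w, J x (v + w) = J x v + J x w) (hsmul : ∀ x (c : ℝ) v, J x (c • v) = c • J x v)
    {ι : Type*} [Fintype ι] {W : ι → ∀ x : M, TangentSpace (𝓡 d) x} {x : M}
    (hW : ∀ i, SmoothFieldAt (W i) x)
    (hspan : ∀ v : TangentSpace (𝓡 d) x, ∃ c : ι → ℝ, ∑ i, c i • W i x = v)
    (hJW : ∀ i, SmoothFieldAt (fun y => J y (W i y)) x)
    {A : ∀ x : M, TangentSpace (𝓡 d) x} (hA : SmoothFieldAt A x) :
    SmoothFieldAt (fun y => J y (A y)) x := by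
  obtain ⟨a, ha, h⟩ := exists_smoothField_coeff hW hspan hA
  refine (SmoothFieldAt.sum (s := Finset.univ) fun i _ => (hJW i).smul (ha i)).congr ?_
  filter_upwards [h] with y hy
  let L : TangentSpace (𝓡 d) y →ₗ[ℝ] TangentSpace (𝓡 d) y :=
    { toFun := J y, map_add' := hadd y, map_smul' := hsmul y }
  change L (A y) = ∑ i, a i y • L (W i y)
  simp only [hy, map_sum, map_smul]

variable {J : ∀ x : M, TangentSpace (𝓡 d) x → TangentSpace (𝓡 d) x}

/-- `[J, J]` is of type `(0, 2)`: it is `J`-antilinear in each argument. -/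
theorem nijenhuis_apply_left (hJ : IsAlmostComplex J) {A C : ∀ x : M, TangentSpace (𝓡 d) x} {x : M}
    (hA : SmoothFieldAt A x) :
    nijenhuis J (fun y => J y (A y)) C x = -J x (nijenhuis J A C x) := by
  have hJJ : (fun y => J y (J y (A y))) = (-1 : ℝ) • A := by
    funext y
    rw [hJ.square]
    simp
  simp only [nijenhuis, hJ.map_add, hJ.map_sub, hJJ]
  rw [VectorField.mlieBracket_const_smul_left hA.mdifferentiableAt,
    VectorField.mlieBracket_const_smul_left hA.mdifferentiableAt, hJ.map_smul, hJ.square,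
    hJ.square]
  module

/-- `[J, J]` vanishes when it vanishes on a family `W` of fields which, together with the fields
`J W`, spans each tangent space. -/
theorem isIntegrable_of_complex_frame (hJ : IsAlmostComplex J) {ι : Type*} [Fintype ι]
    (hW : ∀ x : M, ∃ W : ι → ∀ x : M, TangentSpace (𝓡 d) x, (∀ i, SmoothFieldAt (W i) x) ∧
      (∀ v : TangentSpace (𝓡 d) x, ∃ c c' : ι → ℝ,
        ∑ i, c i • W i x + ∑ i, c' i • J x (W i x) = v) ∧
      ∀ i j, nijenhuis J (W i) (W j) x = 0) : IsIntegrable J := by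
  refine isIntegrable_of_frame hJ (ι := ι ⊕ ι) fun x => ?_
  obtain ⟨W, hW, hspan, hN⟩ := hW x
  have hJl : ∀ {A C : ∀ x : M, TangentSpace (𝓡 d) x}, SmoothFieldAt A x →
      nijenhuis J A C x = 0 → nijenhuis J (fun y => J y (A y)) C x = 0 := by
    intro A C hA h
    rw [nijenhuis_apply_left hJ hA, h, hJ.map_zero, neg_zero]
  have hJr : ∀ {A C : ∀ x : M, TangentSpace (𝓡 d) x}, SmoothFieldAt C x →
      nijenhuis J A C x = 0 → nijenhuis J A (fun y => J y (C y)) x = 0 := by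
    intro A C hC h
    rw [nijenhuis_swap hJ, hJl hC (by rw [nijenhuis_swap hJ, h, neg_zero]), neg_zero]
  refine ⟨Sum.elim W fun i y => J y (W i y), ?_, fun v => ?_, ?_⟩
  · rintro (i | i)
    · exact hW i
    · exact hJ.smooth _ x (hW i)
  · obtain ⟨c, c', h⟩ := hspan v
    exact ⟨Sum.elim c c', by simpa using h⟩
  · rintro (i | i) (j | j)
    · exact hN i j
    · exact hJr (hW j) (hN i j)
    · exact hJl (hW i) (hN i j)
    · exact hJl (hW i) (hJr (hW j) (hN i j))

end General

/-! ### Components of the almost complex structure -/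

namespace InducedHopfBundle

variable {n m : ℕ} {B P : Type*}
  [TopologicalSpace B] [ChartedSpace (EuclideanSpace ℝ (Fin m)) B]
  [TopologicalSpace P] [ChartedSpace (EuclideanSpace ℝ (Fin (m + 3))) P]
  (D : InducedHopfBundle n m B P) {u : Fin 3 → ℍ[ℝ]}

theorem isScalarProduct_baseMetric : IsScalarProduct D.baseMetric where
  symm b v w := by
    obtain ⟨l, -, h⟩ := D.exists_baseMetric_eq_inner b
    rw [h, h, real_inner_comm]
  add_left b v v' w := by
    obtain ⟨l, -, h⟩ := D.exists_baseMetric_eq_inner b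
    rw [h, h, h, map_add, inner_add_left]
  smul_left b c v w := by
    obtain ⟨l, -, h⟩ := D.exists_baseMetric_eq_inner b
    rw [h, h, map_smul, real_inner_smul_left]
  eq_zero b v hv := by
    obtain ⟨l, hl, h⟩ := D.exists_baseMetric_eq_inner b
    rw [h, inner_self_eq_zero] at hv
    exact hl (hv.trans (map_zero l).symm)

section Pointwise

variable (hu : IsQuaternionTriple u)
  (phi : ∀ b : B, TangentSpace (𝓡 m) b →L[ℝ] TangentSpace (𝓡 m) b)
  (xi : ∀ b : B, TangentSpace (𝓡 m) b) (p : P) (v w : TangentSpace (𝓡 (m + 3)) p)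
include hu

theorem etaHat_sub (a : Fin 3) :
    D.etaHat u a p (v - w) = D.etaHat u a p v - D.etaHat u a p w := by
  have h := D.etaHat_add hu a p v ((-1 : ℝ) • w)
  rw [D.etaHat_smul hu, neg_one_smul, ← sub_eq_add_neg] at h
  linarith

theorem dProj_acs (h : phi (D.proj p) (xi (D.proj p)) = 0) :
    D.dProj p (D.acs u phi xi p v) =
      D.etaHat u 2 p v • xi (D.proj p) + phi (D.proj p) (D.dProj p v) := by
  simp only [acs, map_add, map_sub, map_smul, (D.fundamental_spec (hu.re_eq_zero _) p).1,
    D.dProj_lift, liftField, h]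
  simp

theorem etaHat_zero_acs : D.etaHat u 0 p (D.acs u phi xi p v) = -D.etaHat u 1 p v := by
  simp [acs, D.etaHat_add hu, D.etaHat_sub hu, D.etaHat_smul hu, D.etaHat_fundamental hu,
    liftField, D.etaHat_lift hu]

theorem etaHat_one_acs : D.etaHat u 1 p (D.acs u phi xi p v) = D.etaHat u 0 p v := by
  simp [acs, D.etaHat_add hu, D.etaHat_sub hu, D.etaHat_smul hu, D.etaHat_fundamental hu,
    liftField, D.etaHat_lift hu]

theorem etaHat_two_acs : D.etaHat u 2 p (D.acs u phi xi p v) =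
    -D.baseMetric (D.proj p) (xi (D.proj p)) (D.dProj p v) := by
  simp [acs, D.etaHat_add hu, D.etaHat_sub hu, D.etaHat_smul hu, D.etaHat_fundamental hu,
    liftField, D.etaHat_lift hu]

end Pointwise

end InducedHopfBundle

/-! ### The almost complex structure -/

namespace InducedHopfBundle

variable {n m : ℕ} {B P : Type*}
  [TopologicalSpace B] [T2Space B] [SecondCountableTopology B]
  [ChartedSpace (EuclideanSpace ℝ (Fin m)) B] [IsManifold (𝓡 m) ∞ B]
  [TopologicalSpace P] [ChartedSpace (EuclideanSpace ℝ (Fin (m + 3))) P]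
  {D : InducedHopfBundle n m B P} {nabla : Connection m B} {xi : ∀ b : B, TangentSpace (𝓡 m) b}
  (hS : IsSasakian D.baseMetric nabla xi) {u : Fin 3 → ℍ[ℝ]} (hu : IsQuaternionTriple u)
include hS hu

theorem acs_add (p : P) (v w : TangentSpace (𝓡 (m + 3)) p) :
    D.acs u (nabla xi) xi p (v + w) = D.acs u (nabla xi) xi p v + D.acs u (nabla xi) xi p w := by
  have hξ := hS.phi_xi D.isScalarProduct_baseMetric (D.proj p)
  refine D.ext_coframe hu ?_ fun a => ?_
  · simp only [map_add, D.dProj_acs hu _ _ _ _ hξ, D.etaHat_add hu]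
    module
  · fin_cases a <;>
    simp [D.etaHat_add hu, D.etaHat_zero_acs hu, D.etaHat_one_acs hu, D.etaHat_two_acs hu,
      D.isScalarProduct_baseMetric.add_right, add_comm]

theorem acs_smul (p : P) (c : ℝ) (v : TangentSpace (𝓡 (m + 3)) p) :
    D.acs u (nabla xi) xi p (c • v) = c • D.acs u (nabla xi) xi p v := by
  have hξ := hS.phi_xi D.isScalarProduct_baseMetric (D.proj p)
  refine D.ext_coframe hu ?_ fun a => ?_
  · simp only [map_smul, D.dProj_acs hu _ _ _ _ hξ, D.etaHat_smul hu]
    module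
  · fin_cases a <;>
    simp [D.etaHat_smul hu, D.etaHat_zero_acs hu, D.etaHat_one_acs hu, D.etaHat_two_acs hu,
      D.isScalarProduct_baseMetric.smul_right]

theorem acs_acs (p : P) (v : TangentSpace (𝓡 (m + 3)) p) :
    D.acs u (nabla xi) xi p (D.acs u (nabla xi) xi p v) = -v := by
  have hg := D.isScalarProduct_baseMetric
  have hξ := hS.phi_xi hg (D.proj p)
  have hneg (a : Fin 3) : D.etaHat u a p (-v) = -D.etaHat u a p v := by
    simpa using D.etaHat_smul hu a p (-1) v
  refine D.ext_coframe hu ?_ fun a => ?_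
  · simp only [D.dProj_acs hu _ _ _ _ hξ, map_add, map_smul, map_neg, hξ, hS.phi_phi hg,
      D.etaHat_two_acs hu]
    module
  · rw [hneg]
    fin_cases a
    · simp [D.etaHat_zero_acs hu, D.etaHat_one_acs hu]
    · simp [D.etaHat_zero_acs hu, D.etaHat_one_acs hu]
    · simp [D.etaHat_two_acs hu, D.dProj_acs hu _ _ _ _ hξ, hg.add_right, hg.smul_right,
        hS.unit, hS.xi_phi hg]

theorem acs_fundamental_zero :
    (fun p => D.acs u (nabla xi) xi p (D.fundamental (u 0) p)) = D.fundamental (u 1) := by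
  funext p
  have hξ := hS.phi_xi D.isScalarProduct_baseMetric (D.proj p)
  refine D.ext_coframe hu ?_ fun a => ?_
  · simp [D.dProj_acs hu _ _ _ _ hξ, (D.fundamental_spec (hu.re_eq_zero _) p).1,
      D.etaHat_fundamental hu]
  · fin_cases a <;>
    simp [D.etaHat_zero_acs hu, D.etaHat_one_acs hu, D.etaHat_two_acs hu, D.etaHat_fundamental hu,
      (D.fundamental_spec (hu.re_eq_zero _) p).1, D.isScalarProduct_baseMetric.zero_right]

theorem acs_fundamental_two :
    (fun p => D.acs u (nabla xi) xi p (D.fundamental (u 2) p)) = D.liftField xi := by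
  funext p
  have hξ := hS.phi_xi D.isScalarProduct_baseMetric (D.proj p)
  refine D.ext_coframe hu ?_ fun a => ?_
  · simp [D.dProj_acs hu _ _ _ _ hξ, (D.fundamental_spec (hu.re_eq_zero _) p).1,
      D.etaHat_fundamental hu, liftField, D.dProj_lift]
  · fin_cases a <;>
    simp [D.etaHat_zero_acs hu, D.etaHat_one_acs hu, D.etaHat_two_acs hu, D.etaHat_fundamental hu,
      (D.fundamental_spec (hu.re_eq_zero _) p).1, D.isScalarProduct_baseMetric.zero_right,
      liftField, D.etaHat_lift hu]

/-- Since `φξ = 0`, the defining formula of `J` on lifts needs no projection to `ξ⊥` inside `φ`. -/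
theorem acs_lift (p : P) (v : TangentSpace (𝓡 m) (D.proj p)) :
    D.acs u (nabla xi) xi p (D.lift p v) = D.lift p (nabla xi (D.proj p) v) -
      D.baseMetric (D.proj p) (xi (D.proj p)) v • D.fundamental (u 2) p := by
  have hξ := hS.phi_xi D.isScalarProduct_baseMetric (D.proj p)
  refine D.ext_coframe hu ?_ fun a => ?_
  · simp [D.dProj_acs hu _ _ _ _ hξ, (D.fundamental_spec (hu.re_eq_zero _) p).1,
      D.etaHat_lift hu, D.dProj_lift]
  · fin_cases a <;>
    simp [D.etaHat_zero_acs hu, D.etaHat_one_acs hu, D.etaHat_two_acs hu, D.etaHat_fundamental hu,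
      D.etaHat_sub hu, D.etaHat_smul hu, D.etaHat_lift hu, D.dProj_lift]

theorem acs_liftField {X : ∀ b : B, TangentSpace (𝓡 m) b}
    (hX : ∀ b, D.baseMetric b (xi b) (X b) = 0) :
    (fun p => D.acs u (nabla xi) xi p (D.liftField X p)) =
      D.liftField fun b => nabla xi b (X b) := by
  funext p
  rw [liftField, acs_lift hS hu, hX, zero_smul, sub_zero, liftField]

variable [IsManifold (𝓡 (m + 3)) ∞ P]

theorem isAlmostComplex_acs : IsAlmostComplex (D.acs u (nabla xi) xi) where
  map_add := acs_add hS hu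
  map_smul := acs_smul hS hu
  square := acs_acs hS hu
  smooth A p hA := by
    have hg := D.isScalarProduct_baseMetric
    have hξ := hS.phi_xi hg
    let e : Basis (Fin m) ℝ (TangentSpace (𝓡 m) (D.proj p)) :=
      (EuclideanSpace.basisFun (Fin m) ℝ).toBasis
    choose X hX hXe using fun i => exists_smoothField_eq (D.proj p) (e i)
    have hF := fun a => D.smoothField_fundamental hu a
    refine smoothFieldAt_of_frame (acs_add hS hu) (acs_smul hS hu)
      (W := Sum.elim (fun a => D.fundamental (u a)) fun i => D.liftField (X i))
      ?_ (fun v => ?_) ?_ hA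
    · rintro (a | i)
      · exact hF a p
      · exact D.smoothField_liftField hu (hX i) p
    · refine ⟨Sum.elim (fun a => D.etaHat u a p v) (e.repr (D.dProj p v)), ?_⟩
      conv_rhs => rw [D.eq_sum_add_lift hu p v, ← e.sum_repr (D.dProj p v), D.lift_sum_smul]
      simp [liftField, hXe]
    · rintro (a | i)
      · fin_cases a
        · exact (acs_fundamental_zero hS hu).symm ▸ hF 1 p
        · have h : (fun q => D.acs u (nabla xi) xi q (D.fundamental (u 1) q)) =
              fun q => -D.fundamental (u 0) q := by
            funext q
            rw [← acs_fundamental_zero hS hu, acs_acs hS hu]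
          exact h.symm ▸ (hF 0 p).neg
        · exact (acs_fundamental_two hS hu).symm ▸ D.smoothField_liftField hu hS.smooth p
      · simp only [Sum.elim_inr, liftField, acs_lift hS hu]
        exact (D.smoothField_liftField hu (hS.smooth_phi (hX i)) p).sub ((hF 2 p).smul
          ((hS.contMDiff_eta hg (hX i)).contMDiffAt.comp p D.contMDiff_proj.contMDiffAt))

omit [IsManifold (𝓡 m) ∞ B] [IsManifold (𝓡 (m + 3)) ∞ P] [T2Space B]
  [SecondCountableTopology B] hS in
/-- Equal curvatures mean equal vertical parts of the brackets of horizontal lifts. -/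
theorem etaHat_mlieBracket_eq_of_curvature_eq {X Y X' Y' : ∀ b : B, TangentSpace (𝓡 m) b} {p : P}
    (h : D.curvature u (D.liftField X) (D.liftField Y) p =
      D.curvature u (D.liftField X') (D.liftField Y') p) (a : Fin 3) :
    D.etaHat u a p (VectorField.mlieBracket (𝓡 (m + 3)) (D.liftField X) (D.liftField Y) p) =
      D.etaHat u a p
        (VectorField.mlieBracket (𝓡 (m + 3)) (D.liftField X') (D.liftField Y') p) := by
  rw [D.curvature_liftField hu, D.curvature_liftField hu, neg_inj] at h
  have h' := congrArg (fun z => inner ℝ (u a) z) h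
  simpa only [inner_sum_smul hu] using h'

/-- The two brackets that remain are `[ξ₁, ξ₃] = -2 ξ₂` and `J[ξ₂, ξ₃] = 2 Jξ₁`. -/
theorem nijenhuis_fundamental_zero_two (p : P) :
    nijenhuis (D.acs u (nabla xi) xi) (D.fundamental (u 0)) (D.fundamental (u 2)) p = 0 := by
  have h02 : u 0 * u 2 - u 2 * u 0 = (-2 : ℝ) • u 1 := by
    rw [hu.mul_zero_two, hu.mul_two_zero]
    module
  have h12 : u 1 * u 2 - u 2 * u 1 = (2 : ℝ) • u 0 := by
    rw [hu.mul_one_two, hu.mul_two_one]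
    module
  have hJ := isAlmostComplex_acs hS hu
  have h0 := congrFun (acs_fundamental_zero hS hu) p
  simp only [nijenhuis]
  rw [acs_fundamental_zero hS hu, acs_fundamental_two hS hu, D.mlieBracket_fundamental hu h02,
    D.mlieBracket_fundamental hu h12, D.mlieBracket_fundamental_liftField hu 0 hS.smooth,
    D.mlieBracket_fundamental_liftField hu 1 hS.smooth, hJ.map_zero, hJ.map_smul, h0]
  module

variable {X Y : ∀ b : B, TangentSpace (𝓡 m) b} (hX : SmoothField X) (hY : SmoothField Y)
  (hXxi : ∀ b, D.baseMetric b (xi b) (X b) = 0) (hYxi : ∀ b, D.baseMetric b (xi b) (Y b) = 0)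
include hX hXxi

/-- Each of the four terms vanishes. -/
theorem nijenhuis_fundamental_zero_liftField (p : P) :
    nijenhuis (D.acs u (nabla xi) xi) (D.fundamental (u 0)) (D.liftField X) p = 0 := by
  have hφX := hS.smooth_phi hX
  simp only [nijenhuis]
  rw [acs_fundamental_zero hS hu, acs_liftField hS hu hXxi,
    D.mlieBracket_fundamental_liftField hu 0 hX, D.mlieBracket_fundamental_liftField hu 1 hX,
    D.mlieBracket_fundamental_liftField hu 0 hφX, D.mlieBracket_fundamental_liftField hu 1 hφX,
    (isAlmostComplex_acs hS hu).map_zero]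
  simp

/-- Since `[ξ*, X*]` and `[ξ*, (φX)*]` are horizontal, the claim is that the flow of `ξ` preserves
`φ`, and that `[ξ, X]` is orthogonal to `ξ` like `X`. -/
theorem nijenhuis_fundamental_two_liftField
    (h2 : ∀ X : ∀ b : B, TangentSpace (𝓡 m) b, SmoothField X →
      (∀ b, D.baseMetric b (X b) (xi b) = 0) →
      ∀ p, D.curvature u (D.liftField X) (D.liftField xi) p = 0) (p : P) :
    nijenhuis (D.acs u (nabla xi) xi) (D.fundamental (u 2)) (D.liftField X) p = 0 := by
  have hg := D.isScalarProduct_baseMetric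
  have hJ := isAlmostComplex_acs hS hu
  have hφX := hS.smooth_phi hX
  have hξ := hS.phi_xi hg (D.proj p)
  -- horizontal lifts of `ξ` and of fields orthogonal to it have horizontal brackets
  have hvert : ∀ {X : ∀ b : B, TangentSpace (𝓡 m) b}, SmoothField X →
      (∀ b, D.baseMetric b (xi b) (X b) = 0) → ∀ a, D.etaHat u a p
        (VectorField.mlieBracket (𝓡 (m + 3)) (D.liftField xi) (D.liftField X) p) = 0 := by
    intro X hX hXxi a
    have h := h2 X hX (fun b => (hg.symm b _ _).trans (hXxi b)) p
    rw [D.curvature_liftField hu, neg_eq_zero] at h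
    have h' := congrArg (fun z => inner ℝ (u a) z) h
    simp only [inner_sum_smul hu, inner_zero_right] at h'
    have hneg := D.etaHat_smul hu a p (-1)
      (VectorField.mlieBracket (𝓡 (m + 3)) (D.liftField X) (D.liftField xi) p)
    rw [neg_one_smul] at hneg
    rw [VectorField.mlieBracket_swap_apply, hneg, h', mul_zero]
  have hη := hS.eta_mlieBracket_xi hg (D.proj p) hX hXxi
  simp only [nijenhuis]
  rw [acs_fundamental_two hS hu, acs_liftField hS hu hXxi,
    D.mlieBracket_fundamental_liftField hu 2 hX, D.mlieBracket_fundamental_liftField hu 2 hφX,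
    hJ.map_zero, zero_add, add_zero, sub_eq_zero]
  refine D.ext_coframe hu ?_ fun a => ?_
  · rw [D.dProj_acs hu _ _ _ _ hξ, D.dProj_mlieBracket_liftField hu hS.smooth hX,
      D.dProj_mlieBracket_liftField hu hS.smooth hφX, hvert hX hXxi, zero_smul, zero_add,
      hS.mlieBracket_xi_phi _ hX]
  · rw [hvert hφX fun b => hS.xi_phi hg b _]
    fin_cases a
    · simp [D.etaHat_zero_acs hu, hvert hX hXxi]
    · simp [D.etaHat_one_acs hu, hvert hX hXxi]
    · simp [D.etaHat_two_acs hu, D.dProj_mlieBracket_liftField hu hS.smooth hX, hη]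

include hY hYxi

/-- Curvature of type `(1, 1)` cancels the vertical components. -/
theorem nijenhuis_liftField_liftField
    (h1 : ∀ X Y : ∀ b : B, TangentSpace (𝓡 m) b, SmoothField X → SmoothField Y →
      (∀ b, D.baseMetric b (X b) (xi b) = 0) → (∀ b, D.baseMetric b (Y b) (xi b) = 0) →
      ∀ p, D.curvature u (D.liftField fun b => nabla xi b (X b))
          (D.liftField fun b => nabla xi b (Y b)) p =
        D.curvature u (D.liftField X) (D.liftField Y) p) (p : P) :
    nijenhuis (D.acs u (nabla xi) xi) (D.liftField X) (D.liftField Y) p = 0 := by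
  have hg := D.isScalarProduct_baseMetric
  have hJ := isAlmostComplex_acs hS hu
  have hφX := hS.smooth_phi hX
  have hφY := hS.smooth_phi hY
  have hξ := hS.phi_xi hg (D.proj p)
  have hsum := hS.eta_mlieBracket_phi hg (D.proj p) hX hY hXxi hYxi
  have e1 := etaHat_mlieBracket_eq_of_curvature_eq hu (h1 X Y hX hY
    (fun b => (hg.symm b _ _).trans (hXxi b)) (fun b => (hg.symm b _ _).trans (hYxi b)) p)
  -- type `(1, 1)`, applied to `X` and `φY`
  have e2 : ∀ a, D.etaHat u a p (VectorField.mlieBracket (𝓡 (m + 3))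
        (D.liftField fun b => nabla xi b (X b)) (D.liftField Y) p) +
      D.etaHat u a p (VectorField.mlieBracket (𝓡 (m + 3)) (D.liftField X)
        (D.liftField fun b => nabla xi b (Y b)) p) = 0 := by
    intro a
    have h := etaHat_mlieBracket_eq_of_curvature_eq hu (h1 X _ hX hφY
      (fun b => (hg.symm b _ _).trans (hXxi b))
      (fun b => (hg.symm b _ _).trans (hS.xi_phi hg b _)) p) a
    have hYY : D.liftField (fun b => nabla xi b (nabla xi b (Y b))) =
        (-1 : ℝ) • D.liftField Y := by
      funext q
      rw [liftField, hS.phi_phi hg, hYxi, zero_smul, zero_sub, ← neg_one_smul ℝ, D.lift_smul]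
      rfl
    rw [hYY, VectorField.mlieBracket_const_smul_right
      (D.smoothField_liftField hu hY p).mdifferentiableAt, D.etaHat_smul hu] at h
    linarith
  simp only [nijenhuis]
  rw [acs_liftField hS hu hXxi, acs_liftField hS hu hYxi, sub_eq_zero]
  refine D.ext_coframe hu ?_ fun a => ?_
  · rw [map_add, map_add, D.dProj_acs hu _ _ _ _ hξ, D.dProj_acs hu _ _ _ _ hξ,
      D.dProj_mlieBracket_liftField hu hX hY, D.dProj_mlieBracket_liftField hu hφX hY,
      D.dProj_mlieBracket_liftField hu hX hφY, D.dProj_mlieBracket_liftField hu hφX hφY,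
      ← sub_eq_zero, ← hS.nijenhuis_phi hg (D.proj p) hX hY hXxi hYxi,
      eq_neg_of_add_eq_zero_right (e2 2)]
    module
  · rw [D.etaHat_add hu, D.etaHat_add hu, e1]
    fin_cases a
    · simp [D.etaHat_zero_acs hu, add_assoc, ← neg_add, e2]
    · simp [D.etaHat_one_acs hu, add_assoc, e2]
    · simp [D.etaHat_two_acs hu, D.dProj_mlieBracket_liftField hu hφX hY,
        D.dProj_mlieBracket_liftField hu hX hφY]
      linarith

omit hX hXxi hY hYxi in
theorem isIntegrable_acs
    (h1 : ∀ X Y : ∀ b : B, TangentSpace (𝓡 m) b, SmoothField X → SmoothField Y →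
      (∀ b, D.baseMetric b (X b) (xi b) = 0) → (∀ b, D.baseMetric b (Y b) (xi b) = 0) →
      ∀ p, D.curvature u (D.liftField fun b => nabla xi b (X b))
          (D.liftField fun b => nabla xi b (Y b)) p =
        D.curvature u (D.liftField X) (D.liftField Y) p)
    (h2 : ∀ X : ∀ b : B, TangentSpace (𝓡 m) b, SmoothField X →
      (∀ b, D.baseMetric b (X b) (xi b) = 0) →
      ∀ p, D.curvature u (D.liftField X) (D.liftField xi) p = 0) :
    IsIntegrable (D.acs u (nabla xi) xi) := by
  have hg := D.isScalarProduct_baseMetric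
  have hJ := isAlmostComplex_acs hS hu
  refine isIntegrable_of_complex_frame hJ (ι := Fin 2 ⊕ Fin m) fun p => ?_
  let e : Basis (Fin m) ℝ (TangentSpace (𝓡 m) (D.proj p)) :=
    (EuclideanSpace.basisFun (Fin m) ℝ).toBasis
  choose X hX hXxi hXe using fun i => hS.exists_smoothField_perp hg (D.proj p) (e i)
  have h02 := nijenhuis_fundamental_zero_two hS hu p
  have h0 := fun i => nijenhuis_fundamental_zero_liftField hS hu (hX i) (hXxi i) p
  have h2' := fun i => nijenhuis_fundamental_two_liftField hS hu (hX i) (hXxi i) h2 p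
  refine ⟨Sum.elim ![D.fundamental (u 0), D.fundamental (u 2)] fun i => D.liftField (X i),
    ?_, fun v => ?_, ?_⟩
  · rintro (k | i)
    · fin_cases k
      · exact D.smoothField_fundamental hu 0 p
      · exact D.smoothField_fundamental hu 2 p
    · exact D.smoothField_liftField hu (hX i) p
  · refine ⟨Sum.elim ![D.etaHat u 0 p v, D.etaHat u 2 p v] (e.repr (D.dProj p v)),
      Sum.elim ![D.etaHat u 1 p v,
        D.baseMetric (D.proj p) (xi (D.proj p)) (D.dProj p v)] fun _ => 0, ?_⟩
    have hsum : ∑ i, e.repr (D.dProj p v) i • D.liftField (X i) p = D.lift p (D.dProj p v) -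
        D.baseMetric (D.proj p) (xi (D.proj p)) (D.dProj p v) • D.liftField xi p := by
      have hXe' : ∀ i, X i (D.proj p) = -nabla xi (D.proj p) (nabla xi (D.proj p) (e i)) := by
        intro i
        rw [hXe, hS.phi_phi hg, neg_sub]
      obtain ⟨l, hl⟩ := D.exists_lift_eq p
      simp only [liftField, hXe', (hl _).1]
      rw [← map_smul, ← map_sub, ← neg_sub, ← hS.phi_phi hg]
      conv_rhs => rw [← e.sum_repr (D.dProj p v)]
      simp only [map_sum, map_smul, map_neg, smul_neg, Finset.sum_neg_distrib]
    have hJ0 := congrFun (acs_fundamental_zero hS hu) p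
    have hJ2 := congrFun (acs_fundamental_two hS hu) p
    conv_rhs => rw [D.eq_sum_add_lift hu p v]
    simp only [Fintype.sum_sum_type, Fin.sum_univ_two, Fin.sum_univ_three, Sum.elim_inl,
      Sum.elim_inr, Matrix.cons_val_zero, Matrix.cons_val_one, hsum, hJ0, hJ2, zero_smul,
      Finset.sum_const_zero, add_zero]
    module
  · rintro (k | i) (l | j)
    · fin_cases k <;> fin_cases l
      · exact nijenhuis_self hJ _ p
      · exact h02
      · exact (nijenhuis_swap hJ _ _ p).trans (neg_eq_zero.2 h02)
      · exact nijenhuis_self hJ _ p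
    · fin_cases k
      · exact h0 j
      · exact h2' j
    · fin_cases l
      · exact (nijenhuis_swap hJ _ _ p).trans (neg_eq_zero.2 (h0 i))
      · exact (nijenhuis_swap hJ _ _ p).trans (neg_eq_zero.2 (h2' i))
    · exact nijenhuis_liftField_liftField hS hu (hX i) (hX j) (hXxi i) (hXxi j) h1 p

end InducedHopfBundle

end HopfACS

end

theorem proposition4p2 {n m : ℕ} {B P : Type*}
    [TopologicalSpace B] [T2Space B] [SecondCountableTopology B]
    [ChartedSpace (EuclideanSpace ℝ (Fin m)) B] [IsManifold (𝓡 m) ∞ B]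
    [TopologicalSpace P]
    [ChartedSpace (EuclideanSpace ℝ (Fin (m + 3))) P] [IsManifold (𝓡 (m + 3)) ∞ P]
    (D : InducedHopfBundle n m B P)
    (nabla : Connection m B) (xi : ∀ b : B, TangentSpace (𝓡 m) b)
    (hS : IsSasakian D.baseMetric nabla xi)
    (u : Fin 3 → ℍ[ℝ]) (hu : IsQuaternionTriple u)
    (h1 : ∀ X Y : ∀ b : B, TangentSpace (𝓡 m) b, SmoothField X → SmoothField Y →
      (∀ b, D.baseMetric b (X b) (xi b) = 0) → (∀ b, D.baseMetric b (Y b) (xi b) = 0) →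
      ∀ p, D.curvature u (D.liftField fun b => nabla xi b (X b))
          (D.liftField fun b => nabla xi b (Y b)) p =
        D.curvature u (D.liftField X) (D.liftField Y) p)
    (h2 : ∀ X : ∀ b : B, TangentSpace (𝓡 m) b, SmoothField X →
      (∀ b, D.baseMetric b (X b) (xi b) = 0) →
      ∀ p, D.curvature u (D.liftField X) (D.liftField xi) p = 0) :
    IsAlmostComplex (D.acs u (nabla xi) xi) ∧ IsIntegrable (D.acs u (nabla xi) xi) := by
  exact ⟨InducedHopfBundle.isAlmostComplex_acs hS hu,
    InducedHopfBundle.isIntegrable_acs hS hu h1 h2⟩
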